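/- Let $\Psi$ be a random Lipschitz function $\mathbb R\to\mathbb R$, let $A,B$ be real random variables on the same probability space, and write $\Phi(x)=\Psi(x)-Ax$. Let $\mathrm{Lip}(\Psi)=\sup_{s\ne t}|\Psi(t)-\Psi(s)|/|t-s|$. Let $\Psi_1,\Psi_2,\dots$ be i.i.d. copies of $\Psi$ that are Lipschitz, let $R_0$ be a random variable independent of $(\Psi_n)_{n\ge1}$, and let $R_n=\Psi_n(R_{n-1})$ for $n\ge 1$. Consider the equation $$R\stackrel{d}{=}\Psi(R),\qquad R\text{ independent of }\Psi. \tag{1}$$ Assume: * $\mathbb E[\log \mathrm{Lip}(\Psi)]<0$, where $\log 0=-\infty$ and the value $-\infty$ is allowed. * There is a function $\phi:[0,\infty)\to[0,\infty)$, bounded on bounded sets, with $\phi(x)=o(x)$ as $x\to\infty$, such that $|\Phi(x)|\le B\,\phi(|x|)$ a.s. for every $x$ in the support of the law of any solution $R$ of (1), and for at least one $x\in\mathbb R$ (the latter is automatic once a solution exists). * $\mathbb P[B\vee|A|>t]=O(\mathbb P[A>t])$ as $t\to\infty$. * For some $\alpha>0$: $\lim_{t\to\infty}\mathbb P[A>ty]/\mathbb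 P[A>t]=y^{-\alpha}$ for every $y>0$ (in particular $\mathbb P[A>t]>0$ for all $t$); $\mathbb E[|A|^\alpha]<1$; and, with $A'$ an independent copy of $A$ and $x_\pm=\max\{\pm x,0\}$, $$\lim_{t\to\infty}\frac{\mathbb P[A_+A'_+>t]}{\mathbb P[A>t]}=2\,\mathbb E[A_+^\alpha].$$ Then (1) has a solution $R$, its law is unique, and $R_n$ converges weakly to $R$ for every choice of $R_0$. Moreover $$\mathbb P[|R|>t]=O(\mathbb P[A>t])\qquad(t\to\infty).$$ Furthermore: a) Suppose in addition that $\Psi$ is a.s. non-decreasing, that $\mathbb P[A>t,\ \Phi(1)<-t]=o(\mathbb P[A>t])$, and that either $\mathbb P[R\ge 1]>0$ or $\mathbb P[R<-K]>0$ for every $K$. Then $\mathbb P[|R|>t]\asymp\mathbb P[A>t]$, that is, the ratio of the two sides is bounded away from $0$ and $\infty$ for all large $t$. b) Suppose in addition that $f_+,f_-:\mathbb R\to[0,\infty)$ are measurable functions such that, for every $y$ in the support of the law of $R$, $$\lim_{t\to\infty}\frac{\mathbb P[\Psi(y)>t]}{\mathbb P[A>t]}=f_+(y),\qquad \lim_{t\to\infty}\frac{\mathbb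 P[\Psi(y)<-t]}{\mathbb P[A>t]}=f_-(y).$$ Then $\mathbb E[f_+(R)]<\infty$ and $\mathbb E[f_-(R)]<\infty$, and, with $\mu_\pm=\mathbb E[A_\pm^\alpha]$, $$\lim_{t\to\infty}\frac{\mathbb P[R>t]}{\mathbb P[A>t]}=\frac{(1-\mu_+)\,\mathbb E[f_+(R)]+\mu_-\,\mathbb E[f_-(R)]}{(1-\mu_+-\mu_-)(1-\mu_++\mu_-)}.$$ -/

import Mathlib

open MeasureTheory ProbabilityTheory Filter Topology Asymptotics
open scoped ENNReal NNReal

noncomputable section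

namespace IFS

/-- The tail `t ↦ P[X > t]` of a real random variable. -/
def tail {Ω : Type*} [MeasurableSpace Ω] (P : Measure Ω) (X : Ω → ℝ) (t : ℝ) : ℝ :=
  P.real {ω | t < X ω}

/-- `Lip(ψ) = sup_{t ≠ s} |ψ(t) - ψ(s)| / |t - s|`, as an element of `[0, ∞]`. -/
def lip (ψ : ℝ → ℝ) : ℝ≥0∞ :=
  ⨆ (t : ℝ) (s : ℝ) (_ : t ≠ s), ENNReal.ofReal (|ψ t - ψ s| / |t - s|)

/-- `E[log L] < 0` for a `[0, ∞]`-valued `L`, where `log 0 = -∞`: the expectation is taken in the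
extended sense `E[log⁺ L] - E[log⁻ L]`, and `E[log L] = -∞` is allowed. -/
def NegLogMean {Ω : Type*} [MeasurableSpace Ω] (P : Measure Ω) (L : Ω → ℝ≥0∞) : Prop :=
  ∫⁻ ω, (ENNReal.log (L ω)).toENNReal ∂P < ∫⁻ ω, (-ENNReal.log (L ω)).toENNReal ∂P

/-- The law `ν` solves `R =_d Ψ(R)` with `R ∼ ν` independent of `Ψ`. -/
def Solves {Ω : Type*} [MeasurableSpace Ω] (P : Measure Ω) (Ψ : Ω → ℝ → ℝ)
    (ν : ProbabilityMeasure ℝ) : Prop :=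
  ((ν : Measure ℝ).prod P).map (fun p : ℝ × Ω => Ψ p.2 p.1) = (ν : Measure ℝ)

/-- The non-linear part `Φ(x) = Ψ(x) - A x`. -/
def rem {Ω : Type*} (Ψ : Ω → ℝ → ℝ) (A : Ω → ℝ) (ω : Ω) (x : ℝ) : ℝ :=
  Ψ ω x - A ω * x

/-- The chain `R_n = Ψ_n(R_{n-1})`, `n ≥ 1`, started at `R_0`. The maps are indexed from `0`, so
`Ψs n` is the map applied in step `n + 1`. -/
def chain {Ω : Type*} (Ψs : ℕ → Ω → ℝ → ℝ) (R₀ : Ω → ℝ) : ℕ → Ω → ℝ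
  | 0, ω => R₀ ω
  | n + 1, ω => Ψs n ω (chain Ψs R₀ n ω)

end IFS

end

set_option linter.unusedSectionVars false

/-! Existence, uniqueness and convergence come from contraction on average. The law of large numbers
makes the product of the Lipschitz constants decay exponentially. The displacement |Ψ(x₀) - x₀| has
a finite α-th moment, so along the copies it grows at most at an arbitrarily small exponential rate.
Hence the backward iterates Ψ₁∘⋯∘Ψₙ(x₀) converge almost surely, and the law of the limit is
stationary (`Copies.exists_stationary`). Two forward chains driven by the same maps merge, which
gives convergence from every start and uniqueness.

All tail estimates rest on one consequence of the hypothesis on A₊A'₊: a product of two independent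
factors exceeds t with both factors above K only with probability ε P[A > t], once K and then t are
large (`eventually_real_bigSet_self_le`). By stochastic comparison this extends to any two factors
whose tails are O(P[A > t]).

Upper bound: with V = B ∨ |A|, Ψ is dominated by r ↦ (|A| + εV)|r| + DV, where E(|A| + εV)^α < 1. If
|R| has tail at most c P[A > t], one step gives (θc + D') P[A > t] with θ < 1 for large t
(`exists_step_bound`), so a suitable c is preserved. Since ν is not known beforehand to have such a
tail, the iteration starts from ν conditioned on a bounded set and the bound passes to the weak
limit.

Part (a): monotonicity propagates a large value of Ψ(x), at one well-chosen x, to all R on the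
appropriate side of x, an event of positive probability.

Part (b): σΨ(R) > t occurs essentially either with |R| ≤ K, which contributes E[f(R)] by dominated
convergence, or with |A| ≤ K and σAR > t, which is governed by Breiman's lemma and the two tails of
R (`eventually_sandwich`). The candidate limits ℓ± solve ℓ± = E[f±(R)] + μ₊ℓ± + μ₋ℓ∓. Without
assuming that limits exist, an error c in both tail asymptotics improves to c E|A|^α + δ
(`eventually_contraction`), and iterating drives it to zero. -/

namespace IFS

/-! ### Regularly varying tails and truncated moments -/

/-- A positive non-increasing function bounded by one, regularly varying with index `-α`. -/
structure RegVar (F : ℝ → ℝ) (α : ℝ) : Prop where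
  anti : Antitone F
  pos : ∀ t, 0 < F t
  le_one : ∀ t, F t ≤ 1
  lim : ∀ y : ℝ, 0 < y → Tendsto (fun t => F (t * y) / F t) atTop (𝓝 (y ^ (-α)))

theorem tail_antitone {Ω : Type*} [MeasurableSpace Ω] (P : Measure Ω) [IsProbabilityMeasure P]
    (X : Ω → ℝ) : Antitone (tail P X) := fun s t hst =>
  measureReal_mono (fun ω (h : t < X ω) => lt_of_le_of_lt hst h)

theorem tail_nonneg {Ω : Type*} [MeasurableSpace Ω] (P : Measure Ω) (X : Ω → ℝ) (t : ℝ) :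
    0 ≤ tail P X t := measureReal_nonneg

theorem tail_le_one {Ω : Type*} [MeasurableSpace Ω] (P : Measure Ω) [IsProbabilityMeasure P]
    (X : Ω → ℝ) (t : ℝ) : tail P X t ≤ 1 := measureReal_le_one

/-- The limit at y = 1 already forces positivity: a vanishing tail would make the quotient 0 instead
of 1. -/
theorem regVar_tail {Ω : Type*} [MeasurableSpace Ω] {P : Measure Ω} [IsProbabilityMeasure P]
    {A : Ω → ℝ} {α : ℝ}
    (hreg : ∀ y : ℝ, 0 < y →
      Tendsto (fun t => tail P A (t * y) / tail P A t) atTop (𝓝 (y ^ (-α)))) :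
    RegVar (tail P A) α := by
  refine ⟨tail_antitone P A, fun t => ?_, tail_le_one P A, hreg⟩
  have h1 := hreg 1 one_pos
  simp only [mul_one, Real.one_rpow] at h1
  obtain ⟨s, hs, hst⟩ := ((h1.eventually (lt_mem_nhds (zero_lt_one))).and
    (eventually_ge_atTop t)).exists
  have : 0 < tail P A s := by
    rcases (tail_nonneg P A s).eq_or_lt with h | h
    · rw [← h] at hs; simp at hs
    · exact h
  exact this.trans_le (tail_antitone P A hst)

namespace RegVar

variable {F : ℝ → ℝ} {α : ℝ}

theorem measurable (hF : RegVar F α) : Measurable F := hF.anti.measurable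

theorem eventually_le (hF : RegVar F α) {y c : ℝ} (hy : 0 < y) (hc : y ^ (-α) < c) :
    ∀ᶠ t in atTop, F (t * y) ≤ c * F t := by
  filter_upwards [(hF.lim y hy).eventually (gt_mem_nhds hc)] with t ht
  exact ((div_lt_iff₀ (hF.pos t)).1 ht).le

theorem eventually_ge (hF : RegVar F α) {y c : ℝ} (hy : 0 < y) (hc : c < y ^ (-α)) :
    ∀ᶠ t in atTop, c * F t ≤ F (t * y) := by
  filter_upwards [(hF.lim y hy).eventually (lt_mem_nhds hc)] with t ht
  exact ((lt_div_iff₀ (hF.pos t)).1 ht).le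

theorem exists_global_bound (hF : RegVar F α) {g : ℝ → ℝ} (hg : ∀ t, g t ≤ 1) {C : ℝ}
    (h : ∀ᶠ t in atTop, g t ≤ C * F t) : ∃ C' : ℝ, 0 ≤ C' ∧ ∀ t, g t ≤ C' * F t := by
  obtain ⟨T, hT⟩ := eventually_atTop.1 h
  have hp := hF.pos T
  refine ⟨max C (1 / F T), le_max_of_le_right (by positivity), fun t => ?_⟩
  rcases le_total T t with h1 | h1
  · exact (hT t h1).trans (mul_le_mul_of_nonneg_right (le_max_left _ _) (hF.pos t).le)
  · have : 1 ≤ 1 / F T * F t := by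
      rw [one_div, ← div_eq_inv_mul, le_div_iff₀ hp, one_mul]; exact hF.anti h1
    exact (hg t).trans (this.trans (mul_le_mul_of_nonneg_right (le_max_right _ _) (hF.pos t).le))

/-- A dilation of a regularly varying function is of the same order. -/
theorem exists_dilation_bound (hF : RegVar F α) {y : ℝ} (hy : 0 < y) :
    ∃ C : ℝ, 0 ≤ C ∧ ∀ t, F (t * y) ≤ C * F t :=
  hF.exists_global_bound (fun _ => hF.le_one _) (hF.eventually_le hy (lt_add_one _))

theorem tendsto_div (hF : RegVar F α) {x : ℝ} (hx : 0 < x) :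
    Tendsto (fun t => F (t / x) / F t) atTop (𝓝 (x ^ α)) := by
  have := hF.lim x⁻¹ (inv_pos.2 hx)
  rwa [Real.inv_rpow hx.le, Real.rpow_neg hx.le, inv_inv] at this

variable {Ω : Type*} [MeasurableSpace Ω] {P : Measure Ω} [IsProbabilityMeasure P] {X : Ω → ℝ}

theorem integrable_comp_div (hF : RegVar F α) (hX : Measurable X) (t : ℝ) :
    Integrable (fun ω => F (t / X ω)) P := by
  refine Integrable.of_bound (C := 1) (hF.measurable.comp (by fun_prop)).aestronglyMeasurable
    (ae_of_all _ fun ω => ?_)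
  rw [Real.norm_of_nonneg (hF.pos _).le]; exact hF.le_one _

theorem measurableSet_Ioc (hX : Measurable X) (K : ℝ) : MeasurableSet {ω | 0 < X ω ∧ X ω ≤ K} :=
  (measurableSet_lt measurable_const hX).inter (measurableSet_le hX measurable_const)

/-- Truncated Breiman lemma. -/
theorem tendsto_setIntegral_div (hF : RegVar F α) (hX : Measurable X) {K : ℝ} (hK : 0 < K) :
    Tendsto (fun t => (∫ ω in {ω | 0 < X ω ∧ X ω ≤ K}, F (t / X ω) ∂P) / F t) atTop
      (𝓝 (∫ ω in {ω | 0 < X ω ∧ X ω ≤ K}, X ω ^ α ∂P)) := by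
  simp_rw [← integral_div]
  refine tendsto_integral_filter_of_dominated_convergence (fun _ => K ^ α + 1) ?_ ?_
    (integrable_const _) ?_
  · exact Eventually.of_forall fun t =>
      ((hF.measurable.comp (by fun_prop)).div_const _).aestronglyMeasurable
  -- On X ≤ K monotonicity gives F(t/X) ≤ F(t/K), and F(t/K)/F(t) → K^α supplies the constant
  -- majorant.
  · filter_upwards [(hF.tendsto_div hK).eventually (gt_mem_nhds (lt_add_one _)),
      eventually_gt_atTop 0] with t ht ht0
    filter_upwards [ae_restrict_mem (measurableSet_Ioc hX K)] with ω hω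
    rw [Real.norm_of_nonneg (div_nonneg (hF.pos _).le (hF.pos _).le)]
    refine le_trans ?_ ht.le
    refine div_le_div_of_nonneg_right (hF.anti ?_) (hF.pos _).le
    exact div_le_div_of_nonneg_left ht0.le hω.1 hω.2
  · filter_upwards [ae_restrict_mem (measurableSet_Ioc hX K)] with ω hω
    exact hF.tendsto_div hω.1

end RegVar

/-- Truncated moments converge to the moment. -/
theorem tendsto_setIntegral_rpow {Ω : Type*} [MeasurableSpace Ω] {P : Measure Ω}
    {X : Ω → ℝ} {α : ℝ} (hα : 0 < α) (hX : Measurable X)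
    (hint : Integrable (fun ω => max (X ω) 0 ^ α) P) :
    Tendsto (fun K : ℝ => ∫ ω in {ω | 0 < X ω ∧ X ω ≤ K}, X ω ^ α ∂P) atTop
      (𝓝 (∫ ω, max (X ω) 0 ^ α ∂P)) := by
  have hms := fun K => RegVar.measurableSet_Ioc hX K
  simp_rw [← integral_indicator (hms _)]
  refine tendsto_integral_filter_of_dominated_convergence (fun ω => max (X ω) 0 ^ α) ?_ ?_ hint ?_
  · exact Eventually.of_forall fun K =>
      ((hX.pow_const α).indicator (hms K)).aestronglyMeasurable
  · refine Eventually.of_forall fun K => ae_of_all _ fun ω => ?_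
    by_cases h : ω ∈ {ω | 0 < X ω ∧ X ω ≤ K}
    · rw [Set.indicator_of_mem h, max_eq_left h.1.le,
        Real.norm_of_nonneg (Real.rpow_nonneg h.1.le _)]
    · rw [Set.indicator_of_notMem h, norm_zero]; positivity
  · refine ae_of_all _ fun ω => ?_
    refine tendsto_const_nhds.congr' ?_
    filter_upwards [eventually_ge_atTop (X ω)] with K hK
    by_cases h : 0 < X ω
    · rw [Set.indicator_of_mem (show ω ∈ {ω | 0 < X ω ∧ X ω ≤ K} from ⟨h, hK⟩), max_eq_left h.le]
    · rw [Set.indicator_of_notMem (fun h' => h h'.1), max_eq_right (not_lt.1 h),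
        Real.zero_rpow hα.ne']

theorem setIntegral_rpow_le {Ω : Type*} [MeasurableSpace Ω] {P : Measure Ω}
    {X : Ω → ℝ} {α : ℝ} (hX : Measurable X)
    (hint : Integrable (fun ω => max (X ω) 0 ^ α) P) (K : ℝ) :
    ∫ ω in {ω | 0 < X ω ∧ X ω ≤ K}, X ω ^ α ∂P ≤ ∫ ω, max (X ω) 0 ^ α ∂P := by
  calc _ = ∫ ω in {ω | 0 < X ω ∧ X ω ≤ K}, max (X ω) 0 ^ α ∂P :=
        setIntegral_congr_fun (RegVar.measurableSet_Ioc hX K)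
          fun ω hω => by simp only [max_eq_left hω.1.le]
    _ ≤ _ := setIntegral_le_integral hint (ae_of_all _ fun ω => by positivity)

end IFS

namespace IFS

/-! ### Large products of independent factors: one small factor, or both large -/

section Products

variable {Ω₁ Ω₂ Ω₃ : Type*} [MeasurableSpace Ω₁] [MeasurableSpace Ω₂] [MeasurableSpace Ω₃]
  {P : Measure Ω₁} {Q : Measure Ω₂} {P' : Measure Ω₃}
  [IsProbabilityMeasure P] [IsProbabilityMeasure Q] [IsProbabilityMeasure P']
  {X : Ω₁ → ℝ} {Y : Ω₂ → ℝ} {X' : Ω₃ → ℝ}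

theorem real_prod_eq_integral {S : Set (Ω₁ × Ω₂)} (hS : MeasurableSet S) :
    (P.prod Q).real S = ∫ x, Q.real (Prod.mk x ⁻¹' S) ∂P := by
  rw [measureReal_def, Measure.prod_apply hS]
  simp only [measureReal_def]
  rw [integral_toReal (measurable_measure_prodMk_left hS).aemeasurable
    (ae_of_all _ fun x => measure_lt_top _ _)]

theorem integrable_real_slice {S : Set (Ω₁ × Ω₂)} (hS : MeasurableSet S) :
    Integrable (fun x => Q.real (Prod.mk x ⁻¹' S)) P := by
  refine Integrable.of_bound (C := 1)
    (measurable_measure_prodMk_left hS).ennreal_toReal.aestronglyMeasurable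
    (ae_of_all _ fun ω => ?_)
  rw [Real.norm_of_nonneg measureReal_nonneg]; exact measureReal_le_one

theorem real_prod_swap {S : Set (Ω₁ × Ω₂)} (hS : MeasurableSet S) :
    (Q.prod P).real (Prod.swap ⁻¹' S) = (P.prod Q).real S := by
  rw [measureReal_def, measureReal_def, ← Measure.prod_swap (μ := Q) (ν := P),
    Measure.map_apply measurable_swap hS]

theorem integrable_tail_div (hX : Measurable X) (Y : Ω₂ → ℝ) (t : ℝ) :
    Integrable (fun ω => tail Q Y (t / X ω)) P := by
  refine Integrable.of_bound (C := 1)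
    ((tail_antitone Q Y).measurable.comp (by fun_prop)).aestronglyMeasurable
    (ae_of_all _ fun ω => ?_)
  rw [Real.norm_of_nonneg (tail_nonneg _ _ _)]; exact tail_le_one _ _ _

/-- The event that the product exceeds `t` while the first factor lies in `(0, K]`. -/
def smallSet (X : Ω₁ → ℝ) (Y : Ω₂ → ℝ) (K t : ℝ) : Set (Ω₁ × Ω₂) :=
  {p | t < X p.1 * Y p.2 ∧ 0 < X p.1 ∧ X p.1 ≤ K}

/-- The event that the product exceeds `t` while both factors exceed `K`. -/
def bigSet (X : Ω₁ → ℝ) (Y : Ω₂ → ℝ) (K t : ℝ) : Set (Ω₁ × Ω₂) :=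
  {p | t < X p.1 * Y p.2 ∧ K < X p.1 ∧ K < Y p.2}

theorem measurableSet_smallSet (hX : Measurable X) (hY : Measurable Y) (K t : ℝ) :
    MeasurableSet (smallSet X Y K t) := by
  have h1 : Measurable fun p : Ω₁ × Ω₂ => X p.1 := by fun_prop
  have h2 : Measurable fun p : Ω₁ × Ω₂ => Y p.2 := by fun_prop
  exact (measurableSet_lt measurable_const (h1.mul h2)).inter
    ((measurableSet_lt measurable_const h1).inter (measurableSet_le h1 measurable_const))

theorem measurableSet_bigSet (hX : Measurable X) (hY : Measurable Y) (K t : ℝ) :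
    MeasurableSet (bigSet X Y K t) := by
  have h1 : Measurable fun p : Ω₁ × Ω₂ => X p.1 := by fun_prop
  have h2 : Measurable fun p : Ω₁ × Ω₂ => Y p.2 := by fun_prop
  exact (measurableSet_lt measurable_const (h1.mul h2)).inter
    ((measurableSet_lt measurable_const h1).inter (measurableSet_lt measurable_const h2))

theorem real_smallSet (hX : Measurable X) (hY : Measurable Y) (K t : ℝ) :
    (P.prod Q).real (smallSet X Y K t)
      = ∫ ω in {ω | 0 < X ω ∧ X ω ≤ K}, tail Q Y (t / X ω) ∂P := by
  rw [real_prod_eq_integral (measurableSet_smallSet hX hY K t),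
    ← integral_indicator (RegVar.measurableSet_Ioc hX K)]
  refine integral_congr_ae (ae_of_all _ fun ω => ?_)
  by_cases h : 0 < X ω ∧ X ω ≤ K
  · simp only
    rw [Set.indicator_of_mem (show ω ∈ {ω | 0 < X ω ∧ X ω ≤ K} from h), tail]
    congr 1
    ext y
    simp [smallSet, h, div_lt_iff₀ h.1, mul_comm]
  · simp only
    rw [Set.indicator_of_notMem (show ω ∉ {ω | 0 < X ω ∧ X ω ≤ K} from h)]
    have : Prod.mk ω ⁻¹' smallSet X Y K t = ∅ := by
      ext y; simp only [smallSet, Set.mem_preimage, Set.mem_ofPred_eq, Set.mem_empty_iff_false,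
        iff_false]; exact fun h' => h h'.2
    rw [this, measureReal_empty]

/-- Conditionally on Y = y > K the event is that X exceeds max(K, t/y), so a comparison of tails
transfers slice by slice. -/
theorem real_bigSet_le (hX : Measurable X) (hX' : Measurable X') (hY : Measurable Y) {K t C : ℝ}
    (hK : 0 ≤ K) (h : ∀ t, tail P X t ≤ C * tail P' X' t) :
    (P.prod Q).real (bigSet X Y K t) ≤ C * (P'.prod Q).real (bigSet X' Y K t) := by
  have hm := (measurableSet_bigSet hX hY K t)
  have hm' := (measurableSet_bigSet hX' hY K t)
  rw [← real_prod_swap hm, ← real_prod_swap hm',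
    real_prod_eq_integral (measurable_swap hm), real_prod_eq_integral (measurable_swap hm'),
    ← integral_const_mul]
  refine integral_mono (integrable_real_slice (measurable_swap hm))
    ((integrable_real_slice (measurable_swap hm')).const_mul C) fun y => ?_
  by_cases hy : K < Y y
  · have hy0 : 0 < Y y := hK.trans_lt hy
    have key : ∀ {Ω₄ : Type _} (Z : Ω₄ → ℝ), Prod.mk y ⁻¹' (Prod.swap ⁻¹' bigSet Z Y K t)
        = {ω | max K (t / Y y) < Z ω} := by
      intro Ω₄ Z; ext ω
      simp [bigSet, hy, div_lt_iff₀ hy0, and_comm]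
    rw [key X]
    have key' : Prod.mk y ⁻¹' (Prod.swap ⁻¹' bigSet X' Y K t)
        = {ω | max K (t / Y y) < X' ω} := by
      ext ω
      simp [bigSet, hy, div_lt_iff₀ hy0, and_comm]
    simp only [key']
    exact h _
  · have key : Prod.mk y ⁻¹' (Prod.swap ⁻¹' bigSet X Y K t) = ∅ := by
      ext ω; simp [bigSet, hy]
    have key' : Prod.mk y ⁻¹' (Prod.swap ⁻¹' bigSet X' Y K t) = ∅ := by
      ext ω; simp [bigSet, hy]
    simp only [key, key', measureReal_empty, mul_zero, le_refl]

theorem swap_bigSet (X : Ω₁ → ℝ) (Y : Ω₂ → ℝ) (K t : ℝ) :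
    Prod.swap ⁻¹' bigSet X Y K t = bigSet Y X K t := by
  ext p; simp [bigSet, mul_comm, and_comm]

theorem real_bigSet_comm (hX : Measurable X) (hY : Measurable Y) (K t : ℝ) :
    (P.prod Q).real (bigSet X Y K t) = (Q.prod P).real (bigSet Y X K t) := by
  rw [← real_prod_swap (measurableSet_bigSet hX hY K t), swap_bigSet]

theorem real_smallSet_le {F : ℝ → ℝ} {α : ℝ} (hF : RegVar F α) (hX : Measurable X)
    (hY : Measurable Y) {C : ℝ} (h : ∀ t, tail Q Y t ≤ C * F t) (K t : ℝ) :
    (P.prod Q).real (smallSet X Y K t)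
      ≤ C * ∫ ω in {ω | 0 < X ω ∧ X ω ≤ K}, F (t / X ω) ∂P := by
  rw [real_smallSet hX hY, ← integral_const_mul]
  exact integral_mono (integrable_tail_div hX Y t).restrict
    ((hF.integrable_comp_div hX t).restrict.const_mul C) fun ω => h _

theorem setIntegral_div_le {F : ℝ → ℝ} {α : ℝ} (hF : RegVar F α) (hX : Measurable X)
    {K t : ℝ} (ht : 0 < t) : ∫ ω in {ω | 0 < X ω ∧ X ω ≤ K}, F (t / X ω) ∂P ≤ F (t / K) := by
  calc _ ≤ ∫ _ in {ω | 0 < X ω ∧ X ω ≤ K}, F (t / K) ∂P := by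
        refine integral_mono_ae (hF.integrable_comp_div hX t).restrict (integrable_const _) ?_
        filter_upwards [ae_restrict_mem (RegVar.measurableSet_Ioc hX K)] with ω hω
        exact hF.anti (div_le_div_of_nonneg_left ht.le hω.1 hω.2)
    _ = P.real {ω | 0 < X ω ∧ X ω ≤ K} * F (t / K) := by simp
    _ ≤ 1 * F (t / K) := mul_le_mul_of_nonneg_right measureReal_le_one (hF.pos _).le
    _ = _ := one_mul _

/-- If both factors have tails dominated by `F`, so does the event of a large product with a
factor in `(0, K]`. -/
theorem exists_real_smallSet_le {F : ℝ → ℝ} {α : ℝ} (hF : RegVar F α) (hX : Measurable X)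
    (hY : Measurable Y) {C : ℝ} (hC : 0 ≤ C) (h : ∀ t, tail Q Y t ≤ C * F t) {K t : ℝ}
    (ht : 0 < t) : (P.prod Q).real (smallSet X Y K t) ≤ C * F (t / K) :=
  (real_smallSet_le hF hX hY h K t).trans
    (mul_le_mul_of_nonneg_left (setIntegral_div_le hF hX ht) hC)

theorem real_lt_mul_le (hX : Measurable X) (hY : Measurable Y) {K t : ℝ} (hX0 : ∀ ω, 0 ≤ X ω)
    (ht : 0 < t) :
    (P.prod Q).real {p | t < X p.1 * Y p.2} ≤ (P.prod Q).real (smallSet X Y K t)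
      + (Q.prod P).real (smallSet Y X K t) + (P.prod Q).real (bigSet X Y K t) := by
  rw [← real_prod_swap (measurableSet_smallSet hY hX K t)]
  refine le_trans (measureReal_mono (s₂ := smallSet X Y K t ∪ Prod.swap ⁻¹' smallSet Y X K t
    ∪ bigSet X Y K t) ?_) ((measureReal_union_le _ _).trans
      (add_le_add_left (measureReal_union_le _ _) _))
  intro p (hp : t < X p.1 * Y p.2)
  have hpos : 0 < X p.1 * Y p.2 := ht.trans hp
  have hx : 0 < X p.1 := lt_of_le_of_ne (hX0 _) fun h => by simp [← h] at hpos
  have hy : 0 < Y p.2 := (mul_pos_iff_of_pos_left hx).1 hpos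
  by_cases h1 : X p.1 ≤ K
  · exact Or.inl (Or.inl ⟨hp, hx, h1⟩)
  by_cases h2 : Y p.2 ≤ K
  · exact Or.inl (Or.inr ⟨by simpa [mul_comm] using hp, hy, h2⟩)
  · exact Or.inr ⟨hp, not_le.1 h1, not_le.1 h2⟩

end Products

/-! ### Both factors large is negligible -/

section Convolution

variable {Ω : Type*} [MeasurableSpace Ω] {P : Measure Ω} [IsProbabilityMeasure P]
  {A : Ω → ℝ} {α : ℝ}

/-- For t > K² the factors cannot both be at most K, so the three cases are disjoint and the union
bound becomes an identity. -/
theorem real_posPart_prod_eq (hA : Measurable A) {K t : ℝ} (hK : 0 < K) (ht : K * K < t) :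
    tail (P.prod P) (fun p : Ω × Ω => max (A p.1) 0 * max (A p.2) 0) t
      = 2 * (P.prod P).real (smallSet A A K t) + (P.prod P).real (bigSet A A K t) := by
  have ht0 : 0 < t := (mul_pos hK hK).trans ht
  have hm := measurableSet_smallSet hA hA K t
  have hset : {p : Ω × Ω | t < max (A p.1) 0 * max (A p.2) 0}
      = smallSet A A K t ∪ Prod.swap ⁻¹' smallSet A A K t ∪ bigSet A A K t := by
    ext p
    simp only [Set.mem_ofPred_eq, smallSet, bigSet, Set.mem_union, Set.mem_preimage, Prod.fst_swap,
      Prod.snd_swap]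
    constructor
    · intro hp
      have hx : 0 < A p.1 := by
        by_contra h; rw [max_eq_right (not_lt.1 h), zero_mul] at hp; linarith
      have hy : 0 < A p.2 := by
        by_contra h; rw [max_eq_right (not_lt.1 h), mul_zero] at hp; linarith
      rw [max_eq_left hx.le, max_eq_left hy.le] at hp
      by_cases h1 : A p.1 ≤ K
      · exact Or.inl (Or.inl ⟨hp, hx, h1⟩)
      by_cases h2 : A p.2 ≤ K
      · exact Or.inl (Or.inr ⟨by rwa [mul_comm], hy, h2⟩)
      · exact Or.inr ⟨hp, not_le.1 h1, not_le.1 h2⟩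
    · have aux : ∀ x y : ℝ, t < x * y → 0 < x → t < max x 0 * max y 0 := by
        intro x y h hx
        have hy : 0 < y := (mul_pos_iff_of_pos_left hx).1 (ht0.trans h)
        rwa [max_eq_left hx.le, max_eq_left hy.le]
      rintro ((⟨h, hx, -⟩ | ⟨h, hx, -⟩) | ⟨h, hx, -⟩)
      · exact aux _ _ h hx
      · rw [mul_comm]; exact aux _ _ h hx
      · exact aux _ _ h (hK.trans hx)
  have hd1 : Disjoint (smallSet A A K t) (Prod.swap ⁻¹' smallSet A A K t) := by
    rw [Set.disjoint_left]
    rintro p ⟨h, h1, h2⟩ ⟨-, h3, h4⟩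
    simp only [Prod.fst_swap] at h3 h4
    have := mul_le_mul h2 h4 h3.le hK.le
    linarith
  have hd2 : Disjoint (smallSet A A K t ∪ Prod.swap ⁻¹' smallSet A A K t) (bigSet A A K t) := by
    rw [Set.disjoint_left]
    rintro p (⟨-, -, h2⟩ | ⟨-, -, h2⟩) ⟨-, h3, h4⟩
    · linarith
    · simp only [Prod.fst_swap] at h2; linarith
  rw [tail, hset, measureReal_union hd2 (measurableSet_bigSet hA hA K t),
    measureReal_union hd1 (measurable_swap hm), real_prod_swap hm, two_mul]

/-- Relative to P[A > t], the product has limit 2E[A₊^α] and the two cases with a small factor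
contribute 2E[A^α; 0 < A ≤ K]. What is left for the case of two large factors is twice a tail of a
convergent moment integral, small for large K. -/
theorem eventually_real_bigSet_self_le (hα : 0 < α) (hF : RegVar (tail P A) α) (hA : Measurable A)
    (hint : Integrable (fun ω => max (A ω) 0 ^ α) P)
    (hconv : Tendsto
      (fun t => tail (P.prod P) (fun p : Ω × Ω => max (A p.1) 0 * max (A p.2) 0) t
        / tail P A t) atTop (𝓝 (2 * ∫ ω, max (A ω) 0 ^ α ∂P))) {ε : ℝ} (hε : 0 < ε) :
    ∀ᶠ K in atTop, ∀ᶠ t in atTop, (P.prod P).real (bigSet A A K t) ≤ ε * tail P A t := by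
  have h1 := (tendsto_setIntegral_rpow hα hA hint).const_mul 2
  filter_upwards [h1.eventually (lt_mem_nhds (sub_lt_self _ hε)), eventually_gt_atTop 0]
    with K hK hK0
  have h2 := hconv.sub ((hF.tendsto_setIntegral_div (P := P) hA hK0).const_mul 2)
  filter_upwards [h2.eventually (gt_mem_nhds (show _ < ε by linarith)),
    eventually_gt_atTop (K * K)] with t ht htK
  rw [real_posPart_prod_eq hA hK0 htK, real_smallSet hA hA] at ht
  have hp := hF.pos t
  rw [← mul_div_assoc, ← sub_div, div_lt_iff₀ hp] at ht
  linarith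

variable {Ω₁ Ω₂ : Type*} [MeasurableSpace Ω₁] [MeasurableSpace Ω₂] {P₁ : Measure Ω₁}
  {P₂ : Measure Ω₂} [IsProbabilityMeasure P₁] [IsProbabilityMeasure P₂] {X : Ω₁ → ℝ} {Y : Ω₂ → ℝ}

theorem real_bigSet_le_self (hA : Measurable A) (hX : Measurable X) (hY : Measurable Y) {K t C C' : ℝ}
    (hK : 0 ≤ K) (hC : 0 ≤ C) (h : ∀ t, tail P₁ X t ≤ C * tail P A t)
    (h' : ∀ t, tail P₂ Y t ≤ C' * tail P A t) :
    (P₁.prod P₂).real (bigSet X Y K t) ≤ C * C' * (P.prod P).real (bigSet A A K t) := by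
  refine (real_bigSet_le hX hA hY hK h).trans ?_
  rw [mul_assoc, real_bigSet_comm hA hY]
  exact mul_le_mul_of_nonneg_left (real_bigSet_le hY hA hA hK h') hC

theorem exists_tail_mul_le (hF : RegVar (tail P A) α) (hA : Measurable A)
    (hbig : ∀ ε : ℝ, 0 < ε →
      ∀ᶠ K in atTop, ∀ᶠ t in atTop, (P.prod P).real (bigSet A A K t) ≤ ε * tail P A t)
    (hX : Measurable X) (hY : Measurable Y) {C C' : ℝ}
    (hX0 : ∀ ω, 0 ≤ X ω) (hC : 0 ≤ C) (hC' : 0 ≤ C') (h : ∀ t, tail P₁ X t ≤ C * tail P A t)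
    (h' : ∀ t, tail P₂ Y t ≤ C' * tail P A t) :
    ∃ D : ℝ, 0 ≤ D ∧ ∀ t, tail (P₁.prod P₂) (fun p => X p.1 * Y p.2) t ≤ D * tail P A t := by
  obtain ⟨K, hK, hK0⟩ := ((hbig 1 one_pos).and (eventually_gt_atTop 0)).exists
  obtain ⟨c, -, hc⟩ := hF.exists_dilation_bound (inv_pos.2 hK0)
  refine hF.exists_global_bound (fun t => tail_le_one _ _ _) (C := C' * c + C * c + C * C' * 1) ?_
  filter_upwards [hK, eventually_gt_atTop 0] with t ht ht0
  have hct := hc t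
  rw [← div_eq_mul_inv] at hct
  calc _ ≤ _ := real_lt_mul_le (K := K) hX hY hX0 ht0
    _ ≤ C' * tail P A (t / K) + C * tail P A (t / K) + C * C' * (1 * tail P A t) := by
        gcongr
        · exact exists_real_smallSet_le hF hX hY hC' h' ht0
        · exact exists_real_smallSet_le hF hY hX hC h ht0
        · exact (real_bigSet_le_self hA hX hY hK0.le hC h h').trans
            (mul_le_mul_of_nonneg_left ht (mul_nonneg hC hC'))
    _ ≤ C' * (c * tail P A t) + C * (c * tail P A t) + C * C' * (1 * tail P A t) := by gcongr
    _ = _ := by ring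

end Convolution

end IFS

/-! ### Tail bounds for the affine recursion r ↦ M|r| + N -/

namespace IFS

/-- The tail of `A` is regularly varying with index `-α`, and a product of two independent copies
of `A₊` is large only if one of the factors is of order one. -/
structure HeavyTail {Ω : Type*} [MeasurableSpace Ω] (P : Measure Ω) (A : Ω → ℝ) (α : ℝ) :
    Prop where
  pos : 0 < α
  meas : Measurable A
  regVar : RegVar (tail P A) α
  int : Integrable (fun ω => max (A ω) 0 ^ α) P
  big : ∀ ε : ℝ, 0 < ε →
    ∀ᶠ K in atTop, ∀ᶠ t in atTop, (P.prod P).real (bigSet A A K t) ≤ ε * tail P A t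

variable {Ω : Type*} [MeasurableSpace Ω] {P : Measure Ω} [IsProbabilityMeasure P]
  {A M N : Ω → ℝ} {α : ℝ}

/-- Layer-cake formula: both moments are integrals of the tails against the same weight. -/
theorem integrable_rpow_of_tail_le {X : Ω → ℝ} (hα : 0 < α) (hA : Measurable A)
    (hint : Integrable (fun ω => max (A ω) 0 ^ α) P) (hX : Measurable X) (hX0 : ∀ ω, 0 ≤ X ω)
    {C : ℝ} (hC : 0 ≤ C) (h : ∀ t, tail P X t ≤ C * tail P A t) :
    Integrable (fun ω => X ω ^ α) P := by
  refine ⟨(hX.pow_const α).aestronglyMeasurable, ?_⟩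
  rw [hasFiniteIntegral_iff_ofReal (ae_of_all _ fun ω => Real.rpow_nonneg (hX0 ω) _),
    lintegral_rpow_eq_lintegral_meas_lt_mul P (ae_of_all _ hX0) hX.aemeasurable hα]
  have h2 := hint.2
  rw [hasFiniteIntegral_iff_ofReal (ae_of_all _ fun ω => by positivity),
    lintegral_rpow_eq_lintegral_meas_lt_mul P (f := fun ω => max (A ω) 0)
      (ae_of_all _ fun ω => le_max_right _ _)
      (hA.max measurable_const).aemeasurable hα] at h2
  refine lt_of_le_of_lt ?_ (ENNReal.mul_lt_top (ENNReal.ofReal_lt_top (r := C)) h2)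
  rw [mul_left_comm]
  gcongr
  rw [← lintegral_const_mul' _ _ ENNReal.ofReal_ne_top]
  refine setLIntegral_mono' _root_.measurableSet_Ioi fun t ht => ?_
  rw [← mul_assoc]
  gcongr
  have h3 : {a | t < max (A a) 0} = {a | t < A a} := by
    ext a; simp [not_lt.2 (Set.mem_Ioi.1 ht).le]
  rw [h3]
  have h4 := h t
  rw [tail, tail, measureReal_def, measureReal_def] at h4
  rw [← ENNReal.ofReal_toReal (measure_ne_top P {a | t < X a}),
    ← ENNReal.ofReal_toReal (measure_ne_top P {a | t < A a}), ← ENNReal.ofReal_mul hC]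
  exact ENNReal.ofReal_le_ofReal h4

/-- The dependence on c matters. If M ≤ K, Breiman's lemma gives the coefficient E[M^α] + δ; if both
factors exceed K, the coefficient is at most δ; if |r| ≤ K, only the tail of M enters and no c
appears. Neither `D` nor the threshold in t depends on `ν` or c, as iteration requires. -/
theorem exists_tail_mul_abs_le (H : HeavyTail P A α) (hM : Measurable M) (hM0 : ∀ ω, 0 ≤ M ω)
    (hMint : Integrable (fun ω => M ω ^ α) P) {C : ℝ} (hC : 0 ≤ C)
    (hMt : ∀ t, tail P M t ≤ C * tail P A t) {δ : ℝ} (hδ : 0 < δ) :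
    ∃ D : ℝ, 0 ≤ D ∧ ∀ᶠ t in atTop, ∀ (ν : Measure ℝ) [IsProbabilityMeasure ν] (c : ℝ), 0 ≤ c →
      (∀ t, tail ν (fun r => |r|) t ≤ c * tail P A t) →
      (P.prod ν).real {p | t < M p.1 * |p.2|}
        ≤ (((∫ ω, M ω ^ α ∂P) + 2 * δ) * c + D) * tail P A t := by
  have hmax : (fun ω => max (M ω) 0 ^ α) = fun ω => M ω ^ α := by
    funext ω; rw [max_eq_left (hM0 ω)]
  obtain ⟨K, hK, hK0⟩ := ((H.big (δ / (C + 1)) (by positivity)).and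
    (eventually_gt_atTop 0)).exists
  obtain ⟨D, hD0, hD⟩ := H.regVar.exists_dilation_bound (inv_pos.2 hK0)
  refine ⟨C * D, by positivity, ?_⟩
  have h1 := H.regVar.tendsto_setIntegral_div (P := P) hM hK0
  have hm : ∫ ω in {ω | 0 < M ω ∧ M ω ≤ K}, M ω ^ α ∂P ≤ ∫ ω, M ω ^ α ∂P := by
    have := setIntegral_rpow_le hM (hmax ▸ hMint) K
    rwa [hmax] at this
  filter_upwards [hK, eventually_gt_atTop 0,
    h1.eventually (gt_mem_nhds (lt_of_le_of_lt hm (lt_add_of_pos_right _ hδ)))]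
    with t ht ht0 ht1 ν _ c hc hν
  have hp := H.regVar.pos t
  rw [div_lt_iff₀ hp] at ht1
  have hDt := hD t
  rw [← div_eq_mul_inv] at hDt
  have hδC : C * (δ / (C + 1)) ≤ δ := by
    rw [← mul_div_assoc, div_le_iff₀ (by positivity)]; nlinarith
  calc _ ≤ _ := real_lt_mul_le (K := K) hM measurable_norm hM0 ht0
    _ ≤ c * (((∫ ω, M ω ^ α ∂P) + δ) * tail P A t) + C * (D * tail P A t)
        + C * c * ((δ / (C + 1)) * tail P A t) := by
        gcongr
        · exact (real_smallSet_le H.regVar hM measurable_norm hν K t).trans (by gcongr)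
        · exact (exists_real_smallSet_le H.regVar measurable_norm hM hC hMt ht0).trans (by gcongr)
        · exact (real_bigSet_le_self H.meas hM measurable_norm hK0.le hC hMt hν).trans (by gcongr)
    _ = (((∫ ω, M ω ^ α ∂P) + δ + C * (δ / (C + 1))) * c + C * D) * tail P A t := by ring
    _ ≤ _ := by
        have h5 := mul_le_mul_of_nonneg_right hδC hc
        exact mul_le_mul_of_nonneg_right (by linarith) hp.le

/-- If M|r| + N > t, then M|r| > ty or N > t(1-y). With y close to 1 the first event costs hardly
more than M|r| > t, and the second is independent of c. -/
theorem exists_step_bound (H : HeavyTail P A α) (hM : Measurable M) (hN : Measurable N)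
    (hM0 : ∀ ω, 0 ≤ M ω)
    (hMint : Integrable (fun ω => M ω ^ α) P) (hM1 : ∫ ω, M ω ^ α ∂P < 1) {C : ℝ} (hC : 0 ≤ C)
    (hMt : ∀ t, tail P M t ≤ C * tail P A t) (hNt : ∀ t, tail P N t ≤ C * tail P A t) :
    ∃ θ D : ℝ, 0 ≤ θ ∧ θ < 1 ∧ 0 ≤ D ∧
      ∀ᶠ t in atTop, ∀ (ν : Measure ℝ) [IsProbabilityMeasure ν] (c : ℝ), 0 ≤ c →
      (∀ t, tail ν (fun r => |r|) t ≤ c * tail P A t) →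
      (P.prod ν).real {p | t < M p.1 * |p.2| + N p.1} ≤ (θ * c + D) * tail P A t := by
  have hm0 : 0 ≤ ∫ ω, M ω ^ α ∂P := integral_nonneg fun ω => Real.rpow_nonneg (hM0 ω) _
  set m := ∫ ω, M ω ^ α ∂P with hm
  set δ := (1 - m) / 4 with hδ
  have hδ0 : 0 < δ := by rw [hδ]; linarith
  obtain ⟨D, hD0, hD⟩ := exists_tail_mul_abs_le H hM hM0 hMint hC hMt hδ0
  rw [← hm] at hD
  -- The dilation by y may raise the coefficient m + 2δ to m + 3δ at most; the choice δ = (1-m)/4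
  -- keeps this below 1.
  have hq : 1 < (m + 3 * δ) / (m + 2 * δ) := by
    rw [one_lt_div (by positivity)]; linarith
  obtain ⟨y, hy1, hy0, hyq⟩ : ∃ y : ℝ, y < 1 ∧ 0 < y ∧
      y ^ (-α) < (m + 3 * δ) / (m + 2 * δ) := by
    have h1 : Tendsto (fun y : ℝ => y ^ (-α)) (𝓝[<] 1) (𝓝 1) := by
      have := (Real.continuousAt_rpow_const 1 (-α) (Or.inl one_ne_zero)).tendsto
      rw [Real.one_rpow] at this
      exact this.mono_left nhdsWithin_le_nhds
    have h2 : ∀ᶠ y : ℝ in 𝓝[<] 1, 0 < y := nhdsWithin_le_nhds (lt_mem_nhds one_pos)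
    obtain ⟨y, h3, h4, h5⟩ := ((h1.eventually (gt_mem_nhds hq)).and
      (h2.and self_mem_nhdsWithin)).exists
    exact ⟨y, h5, h4, h3⟩
  obtain ⟨E, hE0, hE⟩ := H.regVar.exists_dilation_bound (sub_pos.2 hy1)
  refine ⟨m + 3 * δ, (m + 3 * δ) / (m + 2 * δ) * D + C * E, by positivity, by rw [hδ]; linarith,
    by positivity, ?_⟩
  filter_upwards [(tendsto_id.atTop_mul_const hy0).eventually hD,
    H.regVar.eventually_le hy0 hyq] with t ht1 ht2 ν _ c hc hν
  have h3 := ht1 ν c hc hν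
  simp only [id] at h3
  have hsub : {p : Ω × ℝ | t < M p.1 * |p.2| + N p.1}
      ⊆ {p | t * y < M p.1 * |p.2|} ∪ Prod.fst ⁻¹' {ω | t * (1 - y) < N ω} := by
    intro p hp
    simp only [Set.mem_ofPred_eq, Set.mem_union, Set.mem_preimage] at hp ⊢
    by_contra! h
    nlinarith [h.1, h.2]
  have hfst : (P.prod ν).real (Prod.fst ⁻¹' {ω | t * (1 - y) < N ω}) = tail P N (t * (1 - y)) := by
    rw [tail, measureReal_def, measureReal_def, ← Measure.map_apply measurable_fst
      (measurableSet_lt measurable_const hN)]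
    simp
  calc _ ≤ _ := (measureReal_mono hsub).trans (measureReal_union_le _ _)
    _ ≤ ((m + 2 * δ) * c + D) * ((m + 3 * δ) / (m + 2 * δ) * tail P A t)
        + C * (E * tail P A t) := by
        rw [hfst]
        gcongr
        · exact h3.trans (by gcongr)
        · exact (hNt _).trans (by gcongr; exact hE t)
    _ = _ := by field_simp; ring

/-- The laws of a chain dominated by the affine recursion `x ↦ M x + N` have tails dominated by
that of `A`, uniformly. -/
theorem exists_uniform_tail_bound (H : HeavyTail P A α) (hM : Measurable M) (hN : Measurable N)
    (hM0 : ∀ ω, 0 ≤ M ω)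
    (hMint : Integrable (fun ω => M ω ^ α) P) (hM1 : ∫ ω, M ω ^ α ∂P < 1) {C : ℝ} (hC : 0 ≤ C)
    (hMt : ∀ t, tail P M t ≤ C * tail P A t) (hNt : ∀ t, tail P N t ≤ C * tail P A t)
    (ν : ℕ → Measure ℝ) [∀ n, IsProbabilityMeasure (ν n)] {c₀ : ℝ}
    (h0 : ∀ t, tail (ν 0) (fun r => |r|) t ≤ c₀ * tail P A t)
    (hstep : ∀ n t, tail (ν (n + 1)) (fun r => |r|) t
      ≤ (P.prod (ν n)).real {p | t < M p.1 * |p.2| + N p.1}) :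
    ∃ c : ℝ, 0 ≤ c ∧ ∀ n t, tail (ν n) (fun r => |r|) t ≤ c * tail P A t := by
  obtain ⟨θ, D, hθ0, hθ1, hD0, h⟩ := exists_step_bound H hM hN hM0 hMint hM1 hC hMt hNt
  obtain ⟨T, hT⟩ := eventually_atTop.1 h
  have hpT := H.regVar.pos T
  -- The three terms cover the initial law, the invariance θc + D ≤ c, and the range t ≤ T, where c
  -- P[A > t] ≥ 1 makes the bound trivial.
  set c := max (max c₀ (D / (1 - θ))) (1 / tail P A T) with hc
  have hc0 : 0 ≤ c := le_max_of_le_right (by positivity)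
  have hc1 : θ * c + D ≤ c := by
    have : D / (1 - θ) ≤ c := le_max_of_le_left (le_max_right _ _)
    rw [div_le_iff₀ (by linarith)] at this
    linarith
  refine ⟨c, hc0, fun n => ?_⟩
  induction n with
  | zero =>
    exact fun t => (h0 t).trans (mul_le_mul_of_nonneg_right
      (le_max_of_le_left (le_max_left _ _)) (tail_nonneg _ _ _))
  | succ n ih =>
    intro t
    rcases le_total T t with ht | ht
    · exact (hstep n t).trans ((hT t ht (ν n) c hc0 ih).trans
        (mul_le_mul_of_nonneg_right hc1 (tail_nonneg _ _ _)))
    · refine (tail_le_one _ _ _).trans ?_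
      have : 1 ≤ 1 / tail P A T * tail P A t := by
        rw [one_div, ← div_eq_inv_mul, le_div_iff₀ hpT, one_mul]; exact H.regVar.anti ht
      exact this.trans (mul_le_mul_of_nonneg_right (le_max_right _ _) (tail_nonneg _ _ _))

end IFS

namespace IFS

/-! ### A jointly measurable evaluation map -/

/-- A jointly measurable map which agrees with evaluation on continuous functions. -/
noncomputable def ev (ψ : ℝ → ℝ) (r : ℝ) : ℝ :=
  limsup (fun n : ℕ => ψ ((⌊r * (n + 1)⌋ : ℤ) / ((n : ℝ) + 1))) atTop

/-- Plain evaluation is not jointly measurable for the product σ-algebra. At grid points the second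
argument takes countably many values, so measurability can be checked for each fixed value. -/
theorem measurable_ev : Measurable fun p : (ℝ → ℝ) × ℝ => ev p.1 p.2 := by
  refine Measurable.limsup fun n => ?_
  have h1 : Measurable fun q : (ℝ → ℝ) × ℤ => q.1 ((q.2 : ℝ) / ((n : ℝ) + 1)) :=
    measurable_from_prod_countable_left fun k =>
      measurable_pi_apply (X := fun _ : ℝ => ℝ) ((k : ℝ) / ((n : ℝ) + 1))
  have h2 : Measurable fun p : (ℝ → ℝ) × ℝ => (p.1, ⌊p.2 * ((n : ℝ) + 1)⌋) :=
    measurable_fst.prodMk (Int.measurable_floor.comp (measurable_snd.mul_const _))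
  exact h1.comp h2

theorem measurable_ev_comp {β : Type*} [MeasurableSpace β] {f : β → ℝ → ℝ} {g : β → ℝ}
    (hf : Measurable f) (hg : Measurable g) : Measurable fun b => ev (f b) (g b) :=
  Measurable.comp (g := fun p : (ℝ → ℝ) × ℝ => ev p.1 p.2) (f := fun b => (f b, g b))
    measurable_ev (hf.prodMk hg)

theorem ev_eq {ψ : ℝ → ℝ} (hψ : Continuous ψ) (r : ℝ) : ev ψ r = ψ r := by
  refine Tendsto.limsup_eq ((hψ.tendsto r).comp ?_)
  have h0 : Tendsto (fun n : ℕ => ((n : ℝ) + 1)) atTop atTop :=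
    tendsto_atTop_add_const_right _ _ tendsto_natCast_atTop_atTop
  have h1 : Tendsto (fun n : ℕ => r - 1 / ((n : ℝ) + 1)) atTop (𝓝 r) := by
    simpa using (tendsto_const_nhds (x := r)).sub
      ((tendsto_const_nhds (x := (1 : ℝ))).div_atTop h0)
  refine tendsto_of_tendsto_of_tendsto_of_le_of_le h1 tendsto_const_nhds (fun n => ?_) fun n => ?_
  · have hn : (0 : ℝ) < n + 1 := by positivity
    have := (Int.sub_one_lt_floor (r * ((n : ℝ) + 1))).le
    simp only
    rw [le_div_iff₀ hn, sub_mul, one_div, inv_mul_cancel₀ hn.ne']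
    exact this
  · have hn : (0 : ℝ) < n + 1 := by positivity
    simp only
    rw [div_le_iff₀ hn]
    exact Int.floor_le _

theorem measurable_eval_process {Ω : Type*} [MeasurableSpace Ω] {Ψ : Ω → ℝ → ℝ}
    (hΨ : Measurable Ψ) (hc : ∀ ω, Continuous (Ψ ω)) :
    Measurable fun p : ℝ × Ω => Ψ p.2 p.1 := by
  have : (fun p : ℝ × Ω => Ψ p.2 p.1) = fun p => ev (Ψ p.2) p.1 :=
    funext fun p => (ev_eq (hc _) _).symm
  rw [this]
  exact measurable_ev_comp (hΨ.comp measurable_snd) measurable_fst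

/-! ### The transition operator -/

/-- The law of `Ψ(R)` for `R ∼ ν` independent of `Ψ`. -/
noncomputable def step {Ω : Type*} [MeasurableSpace Ω] (P : Measure Ω) (Ψ : Ω → ℝ → ℝ)
    (ν : Measure ℝ) : Measure ℝ :=
  (ν.prod P).map (fun p : ℝ × Ω => Ψ p.2 p.1)

section Step

variable {Ω Ω' : Type*} [MeasurableSpace Ω] [MeasurableSpace Ω'] {P : Measure Ω} {P' : Measure Ω'}
  [IsProbabilityMeasure P] [IsProbabilityMeasure P'] {Ψ : Ω → ℝ → ℝ} {Ψ' : Ω' → ℝ → ℝ}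

theorem isProbabilityMeasure_step (hΨ : Measurable Ψ) (hc : ∀ ω, Continuous (Ψ ω))
    (ν : Measure ℝ) [IsProbabilityMeasure ν] : IsProbabilityMeasure (step P Ψ ν) :=
  Measure.isProbabilityMeasure_map (measurable_eval_process hΨ hc).aemeasurable

theorem isProbabilityMeasure_iterate_step (hΨ : Measurable Ψ) (hc : ∀ ω, Continuous (Ψ ω))
    (ν : Measure ℝ) [IsProbabilityMeasure ν] (n : ℕ) :
    IsProbabilityMeasure ((step P Ψ)^[n] ν) := by
  induction n with
  | zero => assumption
  | succ n ih =>
    rw [Function.iterate_succ_apply']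
    exact isProbabilityMeasure_step hΨ hc _

/-- The right side depends on `Ψ` only through its law, so copies on another space have the same
transition operator. -/
theorem step_eq_map_ev (hΨ : Measurable Ψ) (hc : ∀ ω, Continuous (Ψ ω)) (ν : Measure ℝ)
    [IsProbabilityMeasure ν] :
    step P Ψ ν = (ν.prod (P.map Ψ)).map (fun p => ev p.2 p.1) := by
  have h1 : ν.prod (P.map Ψ) = (ν.prod P).map (Prod.map id Ψ) := by
    rw [← Measure.map_prod_map _ _ measurable_id hΨ, Measure.map_id]
  rw [h1, Measure.map_map (measurable_ev_comp measurable_snd measurable_fst) (measurable_id.prodMap hΨ), step]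
  congr 1
  exact funext fun p => (ev_eq (hc _) _).symm

theorem step_congr_law (hΨ : Measurable Ψ) (hc : ∀ ω, Continuous (Ψ ω)) (hΨ' : Measurable Ψ')
    (hc' : ∀ ω, Continuous (Ψ' ω)) (h : P'.map Ψ' = P.map Ψ) (ν : Measure ℝ)
    [IsProbabilityMeasure ν] : step P' Ψ' ν = step P Ψ ν := by
  rw [step_eq_map_ev hΨ hc, step_eq_map_ev hΨ' hc', h]

theorem map_eval_of_indepFun (hΨ' : Measurable Ψ')
    (hc' : ∀ ω, Continuous (Ψ' ω)) {R : Ω' → ℝ} (hR : Measurable R) (h : IndepFun R Ψ' P') :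
    P'.map (fun ω => Ψ' ω (R ω)) = step P' Ψ' (P'.map R) := by
  have := Measure.isProbabilityMeasure_map (μ := P') hR.aemeasurable
  rw [step_eq_map_ev hΨ' hc', ← (indepFun_iff_map_prod_eq_prod_map_map hR.aemeasurable
    hΨ'.aemeasurable).1 h, Measure.map_map (measurable_ev_comp measurable_snd measurable_fst) (hR.prodMk hΨ')]
  congr 1
  exact funext fun p => (ev_eq (hc' _) _).symm

end Step

/-! ### Independent copies -/

/-- The maps `Ψs n` are independent Lipschitz copies of `Ψ`. -/
structure Copies {Ω Ω' : Type*} [MeasurableSpace Ω] [MeasurableSpace Ω'] (P : Measure Ω)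
    (Ψ : Ω → ℝ → ℝ) (P' : Measure Ω') (Ψs : ℕ → Ω' → ℝ → ℝ) : Prop where
  meas : ∀ n, Measurable (Ψs n)
  lipschitz : ∀ n ω, ∃ K : ℝ≥0, LipschitzWith K (Ψs n ω)
  law : ∀ n, IdentDistrib (Ψs n) Ψ P' P
  indep : iIndepFun Ψs P'

namespace Copies

variable {Ω Ω' : Type*} [MeasurableSpace Ω] [MeasurableSpace Ω'] {P : Measure Ω} {P' : Measure Ω'}
  [IsProbabilityMeasure P] [IsProbabilityMeasure P'] {Ψ : Ω → ℝ → ℝ} {Ψs : ℕ → Ω' → ℝ → ℝ}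

theorem continuous (h : Copies P Ψ P' Ψs) (n : ℕ) (ω : Ω') : Continuous (Ψs n ω) := by
  obtain ⟨K, hK⟩ := h.lipschitz n ω; exact hK.continuous

theorem shift (h : Copies P Ψ P' Ψs) : Copies P Ψ P' (fun n => Ψs (n + 1)) :=
  ⟨fun _ => h.meas _, fun _ => h.lipschitz _, fun _ => h.law _,
    h.indep.precomp (add_left_injective 1)⟩

theorem indepFun_shift (h : Copies P Ψ P' Ψs) :
    IndepFun (Ψs 0) (fun ω n => Ψs (n + 1) ω) P' := by
  refine IndepFun.indepFun_process (h.meas 0) (fun n => h.meas (n + 1)) fun I => ?_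
  have h1 := h.indep.indepFun_finset {0} (I.image (· + 1)) (by simp) h.meas
  have h2 : Measurable fun f : (({0} : Finset ℕ) → ℝ → ℝ) => f ⟨0, by simp⟩ := measurable_pi_apply _
  have h3 : Measurable fun (f : (I.image (· + 1) : Finset ℕ) → ℝ → ℝ) (i : I) =>
      f ⟨i + 1, Finset.mem_image_of_mem _ i.2⟩ := measurable_pi_lambda _ fun i => measurable_pi_apply _
  exact h1.comp h2 h3

theorem iterate_map_eq (h : Copies P Ψ P' Ψs) (hΨ : Measurable Ψ) (hc : ∀ ω, Continuous (Ψ ω))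
    {R : Ω' → ℝ} (hR : Measurable R) (hind : IndepFun R (Ψs 0) P') :
    P'.map (fun ω => Ψs 0 ω (R ω)) = step P Ψ (P'.map R) := by
  have := Measure.isProbabilityMeasure_map (μ := P') hR.aemeasurable
  rw [map_eval_of_indepFun (h.meas 0) (h.continuous 0) hR hind,
    step_congr_law hΨ hc (h.meas 0) (h.continuous 0) (h.law 0).map_eq]

end Copies

/-- The joint law is a triple product, which can be re-associated. With start, first map and later
maps as the three variables, this makes R₁ independent of the later maps. -/
theorem indepFun_prodMk_of_indepFun {Ω' 𝓧 𝓨 𝓩 : Type*} [MeasurableSpace Ω'] [MeasurableSpace 𝓧]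
    [MeasurableSpace 𝓨] [MeasurableSpace 𝓩] {P' : Measure Ω'} [IsProbabilityMeasure P']
    {X : Ω' → 𝓧} {Y : Ω' → 𝓨} {Z : Ω' → 𝓩} (hX : Measurable X) (hY : Measurable Y)
    (hZ : Measurable Z) (h1 : IndepFun X (fun ω => (Y ω, Z ω)) P') (h2 : IndepFun Y Z P') :
    IndepFun (fun ω => (X ω, Y ω)) Z P' := by
  have h3 : IndepFun X Y P' := h1.comp (φ := id) (ψ := Prod.fst) measurable_id measurable_fst
  rw [indepFun_iff_map_prod_eq_prod_map_map (by fun_prop) (by fun_prop)] at h1 h2 h3 ⊢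
  have := Measure.isProbabilityMeasure_map (μ := P') hX.aemeasurable
  have := Measure.isProbabilityMeasure_map (μ := P') hY.aemeasurable
  have := Measure.isProbabilityMeasure_map (μ := P') hZ.aemeasurable
  rw [h3, ← MeasurableEquiv.map_measurableEquiv_injective MeasurableEquiv.prodAssoc |>.eq_iff]
  rw [Measure.prodAssoc_prod, ← h2, ← h1, Measure.map_map (by fun_prop) (by fun_prop)]
  rfl

/-! ### Laws of the forward chain and of the backward iterates -/

section Chain

variable {Ω Ω' : Type*} [MeasurableSpace Ω] [MeasurableSpace Ω'] {P : Measure Ω} {P' : Measure Ω'}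
  [IsProbabilityMeasure P] [IsProbabilityMeasure P'] {Ψ : Ω → ℝ → ℝ} {Ψs : ℕ → Ω' → ℝ → ℝ}
  {R₀ : Ω' → ℝ}

theorem measurable_chain (h : Copies P Ψ P' Ψs) (hR : Measurable R₀) (n : ℕ) :
    Measurable (chain Ψs R₀ n) := by
  induction n with
  | zero => exact hR
  | succ n ih =>
    exact (measurable_eval_process (h.meas n) (h.continuous n)).comp (ih.prodMk measurable_id)

/-- Absorbing the first map into the start, instead of removing the last one, lets an induction on n
vary the starting point. -/
theorem chain_succ_eq (Ψs : ℕ → Ω' → ℝ → ℝ) (R₀ : Ω' → ℝ) (n : ℕ) :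
    chain Ψs R₀ (n + 1) = chain (fun k => Ψs (k + 1)) (fun ω => Ψs 0 ω (R₀ ω)) n := by
  induction n with
  | zero => rfl
  | succ n ih =>
    funext ω
    rw [chain, ih, chain]

theorem map_chain (hΨ : Measurable Ψ) (hc : ∀ ω, Continuous (Ψ ω)) (h : Copies P Ψ P' Ψs)
    (hR : Measurable R₀) (hind : IndepFun R₀ (fun ω n => Ψs n ω) P') (n : ℕ) :
    P'.map (chain Ψs R₀ n) = (step P Ψ)^[n] (P'.map R₀) := by
  induction n generalizing Ψs R₀ with
  | zero => rfl
  | succ n ih =>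
    have hm : Measurable fun ω n => Ψs (n + 1) ω := measurable_pi_lambda _ fun n => h.meas (n + 1)
    have hev : Measurable fun ω => Ψs 0 ω (R₀ ω) := measurable_chain h hR 1
    have h1 : IndepFun R₀ (fun ω => (Ψs 0 ω, fun n => Ψs (n + 1) ω)) P' :=
      hind.comp (φ := id) (ψ := fun f : ℕ → ℝ → ℝ => (f 0, fun n => f (n + 1))) measurable_id
        ((measurable_pi_apply 0).prodMk (measurable_pi_lambda _ fun n => measurable_pi_apply _))
    have h2 := indepFun_prodMk_of_indepFun hR (h.meas 0) hm h1 h.indepFun_shift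
    have h3 : IndepFun (fun ω => Ψs 0 ω (R₀ ω)) (fun ω n => Ψs (n + 1) ω) P' := by
      have := h2.comp (φ := fun q : ℝ × (ℝ → ℝ) => ev q.2 q.1) (ψ := id)
        (measurable_ev_comp measurable_snd measurable_fst) measurable_id
      convert this using 1
      · exact funext fun ω => (ev_eq (h.continuous 0 ω) _).symm
      · rfl
    rw [chain_succ_eq, ih h.shift hev h3, Function.iterate_succ_apply,
      h.iterate_map_eq hΨ hc hR (h1.comp (φ := id) (ψ := Prod.fst) measurable_id measurable_fst)]

/-- The backward iteration `ψ₀ ∘ ψ₁ ∘ ⋯ ∘ ψ_{n-1}` evaluated at `x`. -/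
noncomputable def backward (x : ℝ) : ℕ → (ℕ → ℝ → ℝ) → ℝ
  | 0, _ => x
  | n + 1, ψs => ev (ψs 0) (backward x n fun k => ψs (k + 1))

theorem measurable_backward (x : ℝ) (n : ℕ) : Measurable (backward x n) := by
  induction n with
  | zero => exact measurable_const
  | succ n ih =>
    exact measurable_ev_comp (measurable_pi_apply 0)
      (ih.comp (measurable_pi_lambda _ fun k => measurable_pi_apply (k + 1)))

theorem measurable_backward_comp (h : Copies P Ψ P' Ψs) (x : ℝ) (n : ℕ) :
    Measurable fun ω => backward x n fun k => Ψs k ω :=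
  (measurable_backward x n).comp (measurable_pi_lambda _ h.meas)

/-- The outermost map is independent of everything inside it, so each extra map applies the
transition operator once: forward and backward iterates agree in law at each fixed n. -/
theorem map_backward (hΨ : Measurable Ψ) (hc : ∀ ω, Continuous (Ψ ω)) (h : Copies P Ψ P' Ψs)
    (x : ℝ) (n : ℕ) :
    P'.map (fun ω => backward x n fun k => Ψs k ω) = (step P Ψ)^[n] (Measure.dirac x) := by
  induction n generalizing Ψs with
  | zero => simp [backward]
  | succ n ih =>
    rw [Function.iterate_succ_apply', ← ih h.shift, ← h.iterate_map_eq hΨ hc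
      (measurable_backward_comp h.shift x n)]
    · congr 1
      exact funext fun ω => ev_eq (h.continuous 0 ω) _
    · exact (h.indepFun_shift.comp measurable_id (measurable_backward x n)).symm

end Chain

end IFS

namespace IFS

/-! ### Truncated logarithm of the Lipschitz constant -/

/-- The Lipschitz constant along the rationals. -/
noncomputable def lipRat (ψ : ℝ → ℝ) : ℝ≥0∞ :=
  ⨆ (t : ℚ) (s : ℚ), ENNReal.ofReal (|ψ t - ψ s| / |(t : ℝ) - s|)

theorem measurable_lipRat : Measurable lipRat :=
  Measurable.iSup fun t => Measurable.iSup fun s =>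
    ((((measurable_pi_apply (t : ℝ)).sub (measurable_pi_apply (s : ℝ))).abs).div_const _).ennreal_ofReal

theorem lipRat_le_lip (ψ : ℝ → ℝ) : lipRat ψ ≤ lip ψ := by
  refine iSup_le fun t => iSup_le fun s => ?_
  -- On the diagonal the quotient is 0/0 = 0, so including it does not change the supremum.
  by_cases h : (t : ℝ) = s
  · simp [h]
  · exact le_iSup_of_le (t : ℝ) (le_iSup_of_le (s : ℝ) (le_iSup_of_le h le_rfl))

theorem lipRat_ne_top {ψ : ℝ → ℝ} {K : ℝ≥0} (h : LipschitzWith K ψ) : lipRat ψ ≠ ∞ := by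
  refine ne_top_of_le_ne_top (ENNReal.ofReal_ne_top (r := K)) (iSup_le fun t => iSup_le fun s => ?_)
  refine ENNReal.ofReal_le_ofReal (div_le_of_le_mul₀ (abs_nonneg _) K.2 ?_)
  simpa [Real.dist_eq] using h.dist_le_mul t s

theorem abs_sub_le_lipRat {ψ : ℝ → ℝ} {K : ℝ≥0} (h : LipschitzWith K ψ) (x y : ℝ) :
    |ψ x - ψ y| ≤ (lipRat ψ).toReal * |x - y| := by
  have hc := h.continuous
  refine Rat.denseRange_cast.induction_on₂ (p := fun x y => |ψ x - ψ y| ≤ (lipRat ψ).toReal * |x - y|)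
    (isClosed_le (by fun_prop) (by fun_prop)) (fun s t => ?_) x y
  rcases eq_or_ne (s : ℝ) t with hst | hst
  · simp [hst]
  · have h1 : ENNReal.ofReal (|ψ s - ψ t| / |(s : ℝ) - t|) ≤ lipRat ψ :=
      le_iSup_of_le s (le_iSup (fun t : ℚ => ENNReal.ofReal (|ψ s - ψ t| / |(s : ℝ) - t|)) t)
    rw [← div_le_iff₀ (abs_pos.2 (sub_ne_zero.2 hst))]
    exact (ENNReal.ofReal_le_iff_le_toReal (lipRat_ne_top h)).1 h1

/-- The logarithm of the Lipschitz constant, truncated from below at `-M`. -/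
noncomputable def logLip (M : ℝ) (ψ : ℝ → ℝ) : ℝ :=
  Real.log (max (lipRat ψ).toReal (Real.exp (-M)))

theorem measurable_logLip (M : ℝ) : Measurable (logLip M) :=
  Real.measurable_log.comp (measurable_lipRat.ennreal_toReal.max measurable_const)

theorem abs_sub_le_exp_logLip {ψ : ℝ → ℝ} {K : ℝ≥0} (h : LipschitzWith K ψ) (M x y : ℝ) :
    |ψ x - ψ y| ≤ Real.exp (logLip M ψ) * |x - y| := by
  rw [logLip, Real.exp_log (lt_max_of_lt_right (Real.exp_pos _))]
  exact (abs_sub_le_lipRat h x y).trans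
    (mul_le_mul_of_nonneg_right (le_max_left _ _) (abs_nonneg _))

/-- Truncating at -M leaves the positive part alone and caps the negative part at M, the form needed
for monotone convergence in M. -/
theorem ofReal_logLip {ψ : ℝ → ℝ} (h : lipRat ψ ≠ ∞) (M : ℕ) :
    ENNReal.ofReal (logLip M ψ) = (ENNReal.log (lipRat ψ)).toENNReal ∧
    ENNReal.ofReal (-logLip M ψ) = min ((-ENNReal.log (lipRat ψ)).toENNReal) M := by
  have hM : (0 : ℝ) ≤ M := M.cast_nonneg
  rcases eq_or_ne (lipRat ψ) 0 with h0 | h0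
  · have : logLip M ψ = -M := by
      rw [logLip, h0, ENNReal.toReal_zero, max_eq_right (Real.exp_pos _).le, Real.log_exp]
    rw [this, h0]
    simp
  · have hx : 0 < (lipRat ψ).toReal := ENNReal.toReal_pos h0 h
    have h1 : logLip M ψ = max (Real.log (lipRat ψ).toReal) (-M) := by
      rw [logLip]
      rcases le_total (lipRat ψ).toReal (Real.exp (-M)) with h2 | h2
      · rw [max_eq_right h2, Real.log_exp, max_eq_right ((Real.log_le_iff_le_exp hx).2 h2)]
      · rw [max_eq_left h2, max_eq_left ((Real.le_log_iff_exp_le hx).2 h2)]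
    rw [ENNReal.log_pos_real h0 h, h1, ← EReal.coe_neg, EReal.real_coe_toENNReal,
      EReal.real_coe_toENNReal]
    constructor
    · rw [(show Monotone ENNReal.ofReal from fun _ _ => ENNReal.ofReal_le_ofReal).map_max,
        ENNReal.ofReal_of_nonpos (p := -(M : ℝ)) (by linarith), max_eq_left zero_le]
    · rw [show ∀ a : ℝ, -max a (-(M : ℝ)) = min (-a) M from fun a => by rw [← min_neg_neg, neg_neg],
        (show Monotone ENNReal.ofReal from fun _ _ => ENNReal.ofReal_le_ofReal).map_min,
        ENNReal.ofReal_natCast]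

/-! ### Exponential contraction along independent copies -/

variable {Ω Ω' : Type*} [MeasurableSpace Ω] [MeasurableSpace Ω'] {P : Measure Ω} {P' : Measure Ω'}
  [IsProbabilityMeasure P] [IsProbabilityMeasure P'] {Ψ : Ω → ℝ → ℝ} {Ψs : ℕ → Ω' → ℝ → ℝ}

/-- As M grows the truncated negative parts increase to the full one, so the strict inequality
between the two parts already holds for some finite M. There the negative part is bounded, hence
both parts are integrable, even if E[log Lip] = -∞. -/
theorem exists_integral_logLip_neg (hΨ : Measurable Ψ) (hl : ∀ ω, ∃ K : ℝ≥0, LipschitzWith K (Ψ ω))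
    (hlog : NegLogMean P (fun ω => lip (Ψ ω))) :
    ∃ M : ℕ, Integrable (fun ω => logLip M (Ψ ω)) P ∧ ∫ ω, logLip M (Ψ ω) ∂P < 0 := by
  have hfin : ∀ ω, lipRat (Ψ ω) ≠ ∞ := fun ω => by
    obtain ⟨K, hK⟩ := hl ω; exact lipRat_ne_top hK
  have h1 : ∫⁻ ω, (ENNReal.log (lipRat (Ψ ω))).toENNReal ∂P
      < ∫⁻ ω, (-ENNReal.log (lipRat (Ψ ω))).toENNReal ∂P := by
    refine lt_of_le_of_lt (lintegral_mono fun ω => ?_) (hlog.trans_le (lintegral_mono fun ω => ?_))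
    · exact EReal.toENNReal_le_toENNReal (ENNReal.log_le_log (lipRat_le_lip _))
    · exact EReal.toENNReal_le_toENNReal
        (EReal.neg_le_neg_iff.2 (ENNReal.log_le_log (lipRat_le_lip _)))
  have hneg : ∀ M : ℕ, Measurable fun ω => ENNReal.ofReal (-logLip M (Ψ ω)) := fun M =>
    ((measurable_logLip M).comp hΨ).neg.ennreal_ofReal
  have h2 : ∫⁻ ω, (-ENNReal.log (lipRat (Ψ ω))).toENNReal ∂P
      = ⨆ M : ℕ, ∫⁻ ω, ENNReal.ofReal (-logLip M (Ψ ω)) ∂P := by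
    rw [← lintegral_iSup hneg]
    · refine lintegral_congr fun ω => ?_
      simp_rw [(ofReal_logLip (hfin ω) _).2]
      rw [← inf_iSup_eq, ENNReal.iSup_natCast, inf_top_eq]
    · intro M M' hMM ω
      simp only [(ofReal_logLip (hfin ω) _).2]
      exact min_le_min_left _ (Nat.cast_le.2 hMM)
  rw [h2, lt_iSup_iff] at h1
  obtain ⟨M, hM⟩ := h1
  have hpos : ∫⁻ ω, ENNReal.ofReal (logLip M (Ψ ω)) ∂P
      = ∫⁻ ω, (ENNReal.log (lipRat (Ψ ω))).toENNReal ∂P :=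
    lintegral_congr fun ω => (ofReal_logLip (hfin ω) M).1
  rw [← hpos] at hM
  have hb : ∫⁻ ω, ENNReal.ofReal (-logLip M (Ψ ω)) ∂P < ∞ := by
    calc _ ≤ ∫⁻ _, (M : ℝ≥0∞) ∂P := lintegral_mono fun ω => by
          simp only [(ofReal_logLip (hfin ω) M).2]; exact min_le_right _ _
      _ < ∞ := by simp
  have hint : Integrable (fun ω => logLip M (Ψ ω)) P := by
    refine ⟨((measurable_logLip M).comp hΨ).aestronglyMeasurable, ?_⟩
    rw [hasFiniteIntegral_iff_norm]
    calc _ ≤ ∫⁻ ω, (ENNReal.ofReal (logLip M (Ψ ω)) + ENNReal.ofReal (-logLip M (Ψ ω))) ∂P := by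
          refine lintegral_mono fun ω => ?_
          rw [Real.norm_eq_abs]
          rcases abs_cases (logLip M (Ψ ω)) with ⟨h, -⟩ | ⟨h, -⟩ <;> simp only [h]
          · exact le_self_add
          · exact le_add_self
      _ = _ := lintegral_add_right _ (hneg M)
      _ < ∞ := ENNReal.add_lt_top.2 ⟨hM.trans hb, hb⟩
  refine ⟨M, hint, ?_⟩
  rw [integral_eq_lintegral_pos_part_sub_lintegral_neg_part hint, sub_neg]
  exact (ENNReal.toReal_lt_toReal (hM.trans hb).ne hb.ne).2 hM

theorem Copies.ae_eventually_sum_le (h : Copies P Ψ P' Ψs) {M : ℝ}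
    (hint : Integrable (fun ω => logLip M (Ψ ω)) P) (hneg : ∫ ω, logLip M (Ψ ω) ∂P < 0) :
    ∃ γ : ℝ, 0 < γ ∧ ∀ᵐ ω ∂P', ∀ᶠ n : ℕ in atTop,
      ∑ i ∈ Finset.range n, logLip M (Ψs i ω) ≤ -(2 * γ) * n := by
  have hid : ∀ n, IdentDistrib (fun ω => logLip M (Ψs n ω)) (fun ω => logLip M (Ψ ω)) P' P :=
    fun n => (h.law n).comp (measurable_logLip M)
  have hslln := strong_law_ae_real (μ := P') (fun n ω => logLip M (Ψs n ω))
    ((hid 0).integrable_iff.2 hint)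
    (fun i j hij => (h.indep.indepFun hij).comp (measurable_logLip M) (measurable_logLip M))
    (fun n => (hid n).trans (hid 0).symm)
  -- The mean is -3γ: the sums eventually lie below -2γn, leaving a rate γ to absorb the
  -- displacements later.
  refine ⟨-(∫ ω, logLip M (Ψ ω) ∂P) / 3, by linarith, ?_⟩
  rw [(hid 0).integral_eq] at hslln
  filter_upwards [hslln] with ω hω
  filter_upwards [hω.eventually (gt_mem_nhds
    (show _ < -(2 * (-(∫ ω, logLip M (Ψ ω) ∂P) / 3)) by linarith)), eventually_gt_atTop 0]
    with n hn hn0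
  rw [div_lt_iff₀ (by exact_mod_cast hn0)] at hn
  exact hn.le

/-- The expectations of |Ψₙ(x) - x|^α e^{-αγn} form a convergent geometric series, so almost surely
the terms tend to zero. -/
theorem Copies.ae_eventually_abs_le (h : Copies P Ψ P' Ψs) {α γ x : ℝ} (hα : 0 < α) (hγ : 0 < γ)
    (hint : Integrable (fun ω => |Ψ ω x - x| ^ α) P) :
    ∀ᵐ ω ∂P', ∀ᶠ n : ℕ in atTop, |Ψs n ω x - x| ≤ Real.exp (γ * n) := by
  have hm : Measurable fun ψ : ℝ → ℝ => |ψ x - x| ^ α :=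
    (((measurable_pi_apply x).sub (measurable_const (a := x))).abs).pow_const α
  have hid : ∀ n, IdentDistrib (fun ω => |Ψs n ω x - x| ^ α) (fun ω => |Ψ ω x - x| ^ α) P' P :=
    fun n => (h.law n).comp hm
  set E := ∫⁻ ω, ENNReal.ofReal (|Ψ ω x - x| ^ α) ∂P with hE
  have hEfin : E ≠ ∞ := by
    have := hint.2
    rw [hasFiniteIntegral_iff_ofReal (ae_of_all _ fun ω => by positivity)] at this
    exact this.ne
  set q := Real.exp (-(α * γ)) with hq
  have hq1 : q < 1 := by rw [hq, Real.exp_lt_one_iff]; nlinarith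
  have hmeas : ∀ n : ℕ, Measurable fun ω => ENNReal.ofReal (|Ψs n ω x - x| ^ α) * ENNReal.ofReal (q ^ n) :=
    fun n => ((hm.comp (h.meas n)).ennreal_ofReal).mul_const _
  have hsum : ∫⁻ ω, ∑' n : ℕ, ENNReal.ofReal (|Ψs n ω x - x| ^ α) * ENNReal.ofReal (q ^ n) ∂P' ≠ ∞ := by
    rw [lintegral_tsum fun n => (hmeas n).aemeasurable]
    have h1 : ∀ n : ℕ, ∫⁻ ω, ENNReal.ofReal (|Ψs n ω x - x| ^ α) * ENNReal.ofReal (q ^ n) ∂P'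
        = E * ENNReal.ofReal (q ^ n) := fun n => by
      have h2 : Measurable fun ω => ENNReal.ofReal (|Ψs n ω x - x| ^ α) :=
        (hm.comp (h.meas n)).ennreal_ofReal
      rw [lintegral_mul_const _ h2, hE]
      congr 1
      exact ((hid n).comp measurable_id.ennreal_ofReal).lintegral_eq
    simp_rw [h1]
    rw [ENNReal.tsum_mul_left, ← ENNReal.ofReal_tsum_of_nonneg (fun n => by positivity)
      (summable_geometric_of_lt_one (Real.exp_pos _).le hq1)]
    exact ENNReal.mul_ne_top hEfin ENNReal.ofReal_ne_top
  filter_upwards [ae_lt_top (Measurable.tsum hmeas) hsum] with ω hω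
  have h0 := ENNReal.tendsto_atTop_zero_of_tsum_ne_top hω.ne
  filter_upwards [h0.eventually (gt_mem_nhds one_pos)] with n hn
  rw [← ENNReal.ofReal_mul (by positivity), ← ENNReal.ofReal_one,
    ENNReal.ofReal_lt_ofReal_iff one_pos] at hn
  rw [← Real.rpow_le_rpow_iff (abs_nonneg _) (Real.exp_pos _).le hα, ← Real.exp_mul]
  have h2 : q ^ n = (Real.exp (γ * n * α))⁻¹ := by
    rw [hq, ← Real.exp_nat_mul, ← Real.exp_neg]; congr 1; ring
  rw [h2, ← div_eq_mul_inv, div_lt_one (Real.exp_pos _)] at hn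
  exact hn.le

/-- Consecutive backward iterates apply the same n outer maps to ψₙ(x) and to x. This is why they
converge pointwise, unlike the forward chain. -/
theorem abs_backward_sub_le {ψs : ℕ → ℝ → ℝ} (h : ∀ n, ∃ K : ℝ≥0, LipschitzWith K (ψs n))
    (M x : ℝ) (n : ℕ) : |backward x (n + 1) ψs - backward x n ψs|
      ≤ Real.exp (∑ i ∈ Finset.range n, logLip M (ψs i)) * |ψs n x - x| := by
  induction n generalizing ψs with
  | zero =>
    obtain ⟨K, hK⟩ := h 0
    simp [backward, ev_eq hK.continuous]
  | succ n ih =>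
    obtain ⟨K, hK⟩ := h 0
    have hb : ∀ m, backward x (m + 1) ψs = ψs 0 (backward x m fun k => ψs (k + 1)) :=
      fun m => ev_eq hK.continuous _
    rw [hb, hb, Finset.sum_range_succ',
      Real.exp_add, mul_comm (Real.exp _) (Real.exp _), mul_assoc]
    exact (abs_sub_le_exp_logLip hK M _ _).trans
      (mul_le_mul_of_nonneg_left (ih fun n => h (n + 1)) (Real.exp_pos _).le)

theorem abs_chain_sub_le (h : ∀ n ω, ∃ K : ℝ≥0, LipschitzWith K (Ψs n ω)) (R R' : Ω' → ℝ)
    (M : ℝ) (n : ℕ) (ω : Ω') : |chain Ψs R n ω - chain Ψs R' n ω|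
      ≤ Real.exp (∑ i ∈ Finset.range n, logLip M (Ψs i ω)) * |R ω - R' ω| := by
  induction n with
  | zero => simp [chain]
  | succ n ih =>
    obtain ⟨K, hK⟩ := h n ω
    rw [chain, chain, Finset.sum_range_succ, Real.exp_add, mul_comm (Real.exp _) (Real.exp _),
      mul_assoc]
    exact (abs_sub_le_exp_logLip hK M _ _).trans
      (mul_le_mul_of_nonneg_left ih (Real.exp_pos _).le)

theorem Copies.exists_ae_tendsto_backward (h : Copies P Ψ P' Ψs) {M α x : ℝ}
    (hint : Integrable (fun ω => logLip M (Ψ ω)) P) (hneg : ∫ ω, logLip M (Ψ ω) ∂P < 0)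
    (hα : 0 < α) (hx : Integrable (fun ω => |Ψ ω x - x| ^ α) P) :
    ∃ Z : Ω' → ℝ, Measurable Z ∧
      ∀ᵐ ω ∂P', Tendsto (fun n => backward x n fun k => Ψs k ω) atTop (𝓝 (Z ω)) := by
  refine measurable_limit_of_tendsto_metrizable_ae
    (fun n => (measurable_backward_comp h x n).aemeasurable) ?_
  obtain ⟨γ, hγ, hsum⟩ := h.ae_eventually_sum_le hint hneg
  filter_upwards [hsum, h.ae_eventually_abs_le hα hγ hx] with ω h1 h2
  refine cauchySeq_tendsto_of_complete (cauchySeq_of_summable_dist ?_)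
  refine Summable.of_norm_bounded_eventually_nat (g := fun n : ℕ => Real.exp (-γ) ^ n)
    (summable_geometric_of_lt_one (Real.exp_pos _).le (by rw [Real.exp_lt_one_iff]; linarith)) ?_
  filter_upwards [h1, h2] with n h3 h4
  rw [Real.norm_of_nonneg dist_nonneg, dist_comm, Real.dist_eq, ← Real.exp_nat_mul]
  refine (abs_backward_sub_le (fun n => h.lipschitz n ω) M x n).trans ?_
  calc _ ≤ Real.exp (-(2 * γ) * n) * Real.exp (γ * n) := by gcongr
    _ = _ := by rw [← Real.exp_add]; congr 1; ring

end IFS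

namespace IFS

/-! ### Stationary law, uniqueness and weak convergence -/

variable {Ω Ω' : Type*} [MeasurableSpace Ω] [MeasurableSpace Ω'] {P : Measure Ω} {P' : Measure Ω'}
  [IsProbabilityMeasure P] [IsProbabilityMeasure P'] {Ψ : Ω → ℝ → ℝ} {Ψs : ℕ → Ω' → ℝ → ℝ}

theorem map_eval_prod (hΨ : Measurable Ψ) (hc : ∀ ω, Continuous (Ψ ω)) {f : Ω' → ℝ}
    (hf : Measurable f) :
    (P'.prod P).map (fun p => Ψ p.2 (f p.1)) = step P Ψ (P'.map f) := by
  have h1 : (P'.map f).prod P = (P'.prod P).map (Prod.map f id) := by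
    have := Measure.isProbabilityMeasure_map (μ := P') hf.aemeasurable
    rw [← Measure.map_prod_map _ _ hf measurable_id, Measure.map_id]
  rw [step, h1, Measure.map_map (measurable_eval_process hΨ hc) (hf.prodMap measurable_id)]
  rfl

theorem tendsto_congr_coe {μs μs' : ℕ → ProbabilityMeasure ℝ} {ν ν' : ProbabilityMeasure ℝ}
    (h : Tendsto μs atTop (𝓝 ν)) (h1 : ∀ n, (μs' n : Measure ℝ) = μs n)
    (h2 : (ν' : Measure ℝ) = ν) : Tendsto μs' atTop (𝓝 ν') := by
  have h3 : μs' = μs := funext fun n => Subtype.ext (h1 n)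
  have h4 : ν' = ν := Subtype.ext h2
  rwa [h3, h4]

/-- The law of the chain after `n` steps. -/
noncomputable def iterLaw (P : Measure Ω) [IsProbabilityMeasure P] (hΨ : Measurable Ψ)
    (hc : ∀ ω, Continuous (Ψ ω)) (ν : ProbabilityMeasure ℝ) (n : ℕ) : ProbabilityMeasure ℝ :=
  ⟨(step P Ψ)^[n] ν, isProbabilityMeasure_iterate_step hΨ hc _ n⟩

/-- Coupling: the chains from `R₀` and from x use the same maps, so their difference vanishes almost
surely, however `R₀` depends on the maps. -/
theorem Copies.tendsto_chain (h : Copies P Ψ P' Ψs) (hΨ : Measurable Ψ)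
    (hc : ∀ ω, Continuous (Ψ ω)) {M x : ℝ}
    (hint : Integrable (fun ω => logLip M (Ψ ω)) P) (hneg : ∫ ω, logLip M (Ψ ω) ∂P < 0)
    {ν : ProbabilityMeasure ℝ}
    (hν : Tendsto (iterLaw P hΨ hc ⟨Measure.dirac x, inferInstance⟩) atTop (𝓝 ν))
    {R₀ : Ω' → ℝ} (hR : Measurable R₀) :
    TendstoInDistribution (chain Ψs R₀) atTop (id : ℝ → ℝ) (fun _ => P') (ν : Measure ℝ) := by
  have hx : TendstoInDistribution (chain Ψs fun _ => x) atTop (id : ℝ → ℝ) (fun _ => P')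
      (ν : Measure ℝ) := by
    refine ⟨fun n => (measurable_chain h measurable_const n).aemeasurable, aemeasurable_id, ?_⟩
    refine tendsto_congr_coe hν (fun n => ?_) Measure.map_id
    simp only [iterLaw, ProbabilityMeasure.coe_mk]
    rw [map_chain hΨ hc h measurable_const (indepFun_const_left x _), Measure.map_const]
    simp
  refine tendstoInDistribution_of_tendstoInMeasure_sub _ _ hx ?_
    fun n => (measurable_chain h hR n).aemeasurable
  refine tendstoInMeasure_of_tendsto_ae (fun n => ((measurable_chain h hR n).sub
    (measurable_chain h measurable_const n)).aestronglyMeasurable) ?_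
  obtain ⟨γ, hγ, hsum⟩ := h.ae_eventually_sum_le hint hneg
  filter_upwards [hsum] with ω hω
  have h0 : Tendsto (fun n : ℕ => Real.exp (-(2 * γ)) ^ n * |R₀ ω - x|) atTop (𝓝 0) := by
    have := (tendsto_pow_atTop_nhds_zero_of_lt_one (Real.exp_pos (-(2 * γ))).le
      (by rw [Real.exp_lt_one_iff]; linarith)).mul_const |R₀ ω - x|
    rwa [zero_mul] at this
  refine squeeze_zero_norm' ?_ h0
  filter_upwards [hω] with n hn
  refine (abs_chain_sub_le h.lipschitz _ _ M n ω).trans ?_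
  rw [← Real.exp_nat_mul]
  gcongr
  linarith

/-- The given space need not carry an independent start with a prescribed law; adjoining a factor
provides one, so that every initial law is realised by a chain. -/
theorem Copies.prod_space (h : Copies P Ψ P' Ψs) (ν : Measure ℝ) [IsProbabilityMeasure ν] :
    Copies P Ψ (P'.prod ν) (fun n p => Ψs n p.1) := by
  have hfst : MeasurePreserving (Prod.fst : Ω' × ℝ → Ω') (P'.prod ν) P' := measurePreserving_fst
  have hm : ∀ n, Measurable fun p : Ω' × ℝ => Ψs n p.1 := fun n => (h.meas n).comp measurable_fst
  have hlaw : ∀ n, (P'.prod ν).map (fun p : Ω' × ℝ => Ψs n p.1) = P'.map (Ψs n) := fun n => by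
    conv_rhs => rw [← hfst.map_eq, Measure.map_map (h.meas n) measurable_fst]
    rfl
  refine ⟨hm, fun n p => h.lipschitz n p.1, fun n => ⟨(hm n).aemeasurable, (h.law n).2, ?_⟩, ?_⟩
  · rw [hlaw, (h.law n).map_eq]
  · rw [iIndepFun_iff_map_fun_eq_infinitePi_map hm]
    simp_rw [hlaw]
    rw [← (iIndepFun_iff_map_fun_eq_infinitePi_map h.meas).1 h.indep]
    conv_rhs => rw [← hfst.map_eq, Measure.map_map (measurable_pi_lambda _ h.meas) measurable_fst]
    rfl

theorem Copies.tendsto_iterLaw (h : Copies P Ψ P' Ψs) (hΨ : Measurable Ψ)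
    (hc : ∀ ω, Continuous (Ψ ω)) {M x : ℝ}
    (hint : Integrable (fun ω => logLip M (Ψ ω)) P) (hneg : ∫ ω, logLip M (Ψ ω) ∂P < 0)
    {ν : ProbabilityMeasure ℝ}
    (hν : Tendsto (iterLaw P hΨ hc ⟨Measure.dirac x, inferInstance⟩) atTop (𝓝 ν))
    (ν' : ProbabilityMeasure ℝ) : Tendsto (iterLaw P hΨ hc ν') atTop (𝓝 ν) := by
  have h' := h.prod_space ν'
  have hsnd : (P'.prod (ν' : Measure ℝ)).map (Prod.snd : Ω' × ℝ → ℝ) = ν' :=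
    measurePreserving_snd.map_eq
  have hind : IndepFun (Prod.snd : Ω' × ℝ → ℝ) (fun p n => Ψs n p.1) (P'.prod ν') :=
    (indepFun_prod (X := fun ω n => Ψs n ω) (Y := id) (measurable_pi_lambda _ h.meas)
      measurable_id).symm
  have h1 := (h'.tendsto_chain hΨ hc hint hneg hν measurable_snd).tendsto
  refine tendsto_congr_coe h1 (fun n => ?_) Measure.map_id.symm
  simp only [iterLaw, ProbabilityMeasure.coe_mk]
  rw [map_chain hΨ hc h' measurable_snd hind, hsnd]

/-- Let Z be the almost sure limit of the backward iterates. Applying a fresh independent Ψ passes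
to the limit by continuity, while in law it only shifts n by one; so Ψ(Z) and Z have the same law.
-/
theorem Copies.exists_stationary (h : Copies P Ψ P' Ψs) (hΨ : Measurable Ψ)
    (hc : ∀ ω, Continuous (Ψ ω)) {M α x : ℝ}
    (hint : Integrable (fun ω => logLip M (Ψ ω)) P) (hneg : ∫ ω, logLip M (Ψ ω) ∂P < 0)
    (hα : 0 < α) (hx : Integrable (fun ω => |Ψ ω x - x| ^ α) P) :
    ∃ ν : ProbabilityMeasure ℝ, step P Ψ ν = ν ∧
      Tendsto (iterLaw P hΨ hc ⟨Measure.dirac x, inferInstance⟩) atTop (𝓝 ν) := by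
  obtain ⟨Z, hZm, hZ⟩ := h.exists_ae_tendsto_backward hint hneg hα hx
  have hb := fun n => measurable_backward_comp h x n
  have h1 := (tendstoInDistribution_of_ae_tendsto (fun n => (hb n).aemeasurable)
    hZm.aemeasurable hZ).tendsto
  have hlim : Tendsto (iterLaw P hΨ hc ⟨Measure.dirac x, inferInstance⟩) atTop
      (𝓝 ⟨P'.map Z, Measure.isProbabilityMeasure_map hZm.aemeasurable⟩) := by
    refine tendsto_congr_coe h1 (fun n => ?_) rfl
    simp only [iterLaw, ProbabilityMeasure.coe_mk]
    rw [map_backward hΨ hc h]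
  refine ⟨_, ?_, hlim⟩
  have hev := measurable_eval_process hΨ hc
  have hcomp : ∀ {f : Ω' → ℝ}, Measurable f → Measurable fun p : Ω' × Ω => Ψ p.2 (f p.1) :=
    fun hf => hev.comp ((hf.comp measurable_fst).prodMk measurable_snd)
  have h2 := (tendstoInDistribution_of_ae_tendsto (μ' := P'.prod P) (l := atTop)
    (X := fun n p => Ψ p.2 (backward x n fun k => Ψs k p.1)) (Z := fun p => Ψ p.2 (Z p.1))
    (fun n => (hcomp (hb n)).aemeasurable) (hcomp hZm).aemeasurable (by
      filter_upwards [measurePreserving_fst.quasiMeasurePreserving.ae hZ] with p hp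
      exact ((hc p.2).tendsto _).comp hp)).tendsto
  have h3 : Tendsto (fun n => iterLaw P hΨ hc ⟨Measure.dirac x, inferInstance⟩ (n + 1)) atTop
      (𝓝 (⟨step P Ψ (P'.map Z), by
        rw [← map_eval_prod hΨ hc hZm]
        exact Measure.isProbabilityMeasure_map (hcomp hZm).aemeasurable⟩ : ProbabilityMeasure ℝ)) := by
    refine tendsto_congr_coe h2 (fun n => ?_) (map_eval_prod hΨ hc hZm).symm
    simp only [iterLaw, ProbabilityMeasure.coe_mk]
    rw [map_eval_prod hΨ hc (hb n), map_backward hΨ hc h, Function.iterate_succ_apply']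
  exact congrArg (fun μ : ProbabilityMeasure ℝ => (μ : Measure ℝ)) (tendsto_nhds_unique h3 ((tendsto_add_atTop_iff_nat 1).2 hlim))

theorem iterLaw_of_stationary (hΨ : Measurable Ψ) (hc : ∀ ω, Continuous (Ψ ω))
    {ν : ProbabilityMeasure ℝ} (hν : step P Ψ ν = ν) (n : ℕ) : iterLaw P hΨ hc ν n = ν :=
  Subtype.ext (Function.iterate_fixed hν n)

end IFS

/-! ### The upper tail bound for the stationary law -/

namespace IFS

theorem real_mono_of_ae {β : Type*} [MeasurableSpace β] {μ : Measure β} [IsFiniteMeasure μ]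
    {s t : Set β} (h : ∀ᵐ x ∂μ, x ∈ s → x ∈ t) : μ.real s ≤ μ.real t :=
  ENNReal.toReal_mono (measure_ne_top _ _) (measure_mono_ae h)

/-- A stationary law `ν` of the random map `Ψ`, which is close to `x ↦ A x` up to an error
controlled by `V φ(|x|)`. -/
structure Model {Ω : Type*} [MeasurableSpace Ω] (P : Measure Ω) (Ψ : Ω → ℝ → ℝ) (A V : Ω → ℝ)
    (φ : ℝ → ℝ) (α : ℝ) (ν : Measure ℝ) : Prop where
  heavy : HeavyTail P A α
  measΨ : Measurable Ψ
  cont : ∀ ω, Continuous (Ψ ω)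
  measV : Measurable V
  abs_le : ∀ ω, |A ω| ≤ V ω
  tail_le : ∃ C : ℝ, 0 ≤ C ∧ ∀ t, tail P V t ≤ C * tail P A t
  phi_le : ∀ ε : ℝ, 0 < ε → ∃ C : ℝ, 0 ≤ C ∧ ∀ x, 0 ≤ x → φ x ≤ ε * x + C
  moment : ∫ ω, |A ω| ^ α ∂P < 1
  approx : ∀ᵐ r ∂ν, ∀ᵐ ω ∂P, |rem Ψ A ω r| ≤ V ω * φ |r|
  stationary : step P Ψ ν = ν

/-- Dominated convergence as ε ↓ 0, with majorant (2V)^α. -/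
theorem exists_pos_integral_add_lt_one {Ω : Type*} [MeasurableSpace Ω] {P : Measure Ω}
    {A V : Ω → ℝ} {α : ℝ} (hα : 0 < α) (hA : Measurable A) (hV : Measurable V)
    (hAV : ∀ ω, |A ω| ≤ V ω) (hint : Integrable (fun ω => V ω ^ α) P)
    (h1 : ∫ ω, |A ω| ^ α ∂P < 1) :
    ∃ ε : ℝ, 0 < ε ∧ Integrable (fun ω => (|A ω| + ε * V ω) ^ α) P ∧
      ∫ ω, (|A ω| + ε * V ω) ^ α ∂P < 1 := by
  have hV0 : ∀ ω, 0 ≤ V ω := fun ω => (abs_nonneg _).trans (hAV ω)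
  have hbd : ∀ ε : ℝ, 0 < ε → ε ≤ 1 → ∀ ω, ‖(|A ω| + ε * V ω) ^ α‖ ≤ 2 ^ α * V ω ^ α := by
    intro ε h0 h1 ω
    have := mul_nonneg h0.le (hV0 ω)
    rw [Real.norm_of_nonneg (by positivity), ← Real.mul_rpow zero_le_two (hV0 ω)]
    refine Real.rpow_le_rpow (by positivity) ?_ hα.le
    nlinarith [hAV ω, mul_le_mul_of_nonneg_right h1 (hV0 ω)]
  have hmeas : ∀ ε : ℝ, AEStronglyMeasurable (fun ω => (|A ω| + ε * V ω) ^ α) P := fun ε =>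
    ((hA.abs.add (hV.const_mul ε)).pow_const α).aestronglyMeasurable
  have hev : ∀ᶠ ε : ℝ in 𝓝[>] 0, 0 < ε ∧ ε ≤ 1 :=
    (eventually_mem_nhdsWithin).and (nhdsWithin_le_nhds (ge_mem_nhds one_pos))
  have hlim : Tendsto (fun ε : ℝ => ∫ ω, (|A ω| + ε * V ω) ^ α ∂P) (𝓝[>] 0)
      (𝓝 (∫ ω, |A ω| ^ α ∂P)) := by
    refine tendsto_integral_filter_of_dominated_convergence (fun ω => 2 ^ α * V ω ^ α)
      (Eventually.of_forall hmeas) ?_ (hint.const_mul _) (ae_of_all _ fun ω => ?_)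
    · filter_upwards [hev] with ε hε
      exact ae_of_all _ (hbd ε hε.1 hε.2)
    · have h2 : ContinuousAt (fun ε : ℝ => (|A ω| + ε * V ω) ^ α) 0 :=
        ContinuousAt.rpow_const (by fun_prop) (Or.inr hα.le)
      have h3 := h2.tendsto
      simp only [zero_mul, add_zero] at h3
      exact h3.mono_left nhdsWithin_le_nhds
  obtain ⟨ε, h2, h3⟩ := ((hlim.eventually (gt_mem_nhds h1)).and hev).exists
  exact ⟨ε, h3.1, (hint.const_mul (2 ^ α)).mono' (hmeas ε) (ae_of_all _ (hbd ε h3.1 h3.2)), h2⟩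

/-- The error bound on Φ is known only for `ν`-almost every point. Applied with stationary `ν`, this
keeps all iterates of a law dominated by `ν` inside that set. -/
theorem step_absolutelyContinuous {Ω : Type*} [MeasurableSpace Ω] {P : Measure Ω}
    [IsProbabilityMeasure P] {Ψ : Ω → ℝ → ℝ} (hΨ : Measurable Ψ) (hc : ∀ ω, Continuous (Ψ ω))
    {μ ν : Measure ℝ} [SFinite μ] [SFinite ν] (h : μ ≪ ν) : step P Ψ μ ≪ step P Ψ ν :=
  (h.prod (Measure.AbsolutelyContinuous.refl P)).map (measurable_eval_process hΨ hc)

namespace Model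

variable {Ω : Type*} [MeasurableSpace Ω] {P : Measure Ω} [IsProbabilityMeasure P]
  {Ψ : Ω → ℝ → ℝ} {A V : Ω → ℝ} {φ : ℝ → ℝ} {α : ℝ} {ν : Measure ℝ} [IsProbabilityMeasure ν]

theorem V_nonneg (H : Model P Ψ A V φ α ν) (ω : Ω) : 0 ≤ V ω := (abs_nonneg _).trans (H.abs_le ω)

theorem integrable_V (H : Model P Ψ A V φ α ν) : Integrable (fun ω => V ω ^ α) P := by
  obtain ⟨C, hC, h⟩ := H.tail_le
  exact integrable_rpow_of_tail_le H.heavy.pos H.heavy.meas H.heavy.int H.measV H.V_nonneg hC h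

theorem measurable_eval (H : Model P Ψ A V φ α ν) : Measurable fun p : ℝ × Ω => Ψ p.2 p.1 :=
  measurable_eval_process H.measΨ H.cont

/-- `φ` is not assumed measurable, so Fubini is applied with a measurable majorant `g` in its place.
-/
theorem ae_abs_rem_le (H : Model P Ψ A V φ α ν) {μ : Measure ℝ} [IsProbabilityMeasure μ]
    (hμ : μ ≪ ν) {g : ℝ → ℝ} (hg : Measurable g) (hφg : ∀ r, φ |r| ≤ g r) :
    ∀ᵐ p ∂(μ.prod P), |Ψ p.2 p.1 - A p.2 * p.1| ≤ V p.2 * g p.1 := by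
  have hm : MeasurableSet {p : ℝ × Ω | |Ψ p.2 p.1 - A p.2 * p.1| ≤ V p.2 * g p.1} := by
    have h1 := H.measurable_eval
    have h2 := H.measV
    have h3 := H.heavy.meas
    have h4 : Measurable fun p : ℝ × Ω => Ψ p.2 p.1 - A p.2 * p.1 := h1.sub (by fun_prop)
    exact measurableSet_le h4.abs (by fun_prop)
  refine (Measure.ae_prod_mem_iff_ae_ae_mem hm).2 ?_
  filter_upwards [hμ.ae_le H.approx] with r hr
  filter_upwards [hr] with ω hω
  exact hω.trans (mul_le_mul_of_nonneg_left (hφg r) (H.V_nonneg ω))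

theorem tail_const_mul_V_le (H : Model P Ψ A V φ α ν) {c : ℝ} (hc : 0 ≤ c) :
    ∃ C : ℝ, 0 ≤ C ∧ ∀ t, tail P (fun ω => c * V ω) t ≤ C * tail P A t := by
  obtain ⟨C, hC, h⟩ := H.tail_le
  have hc1 : 0 < c + 1 := by linarith
  obtain ⟨D, hD, hDt⟩ := H.heavy.regVar.exists_dilation_bound (inv_pos.2 hc1)
  refine H.heavy.regVar.exists_global_bound (fun t => tail_le_one _ _ _) (C := C * D) ?_
  filter_upwards [eventually_gt_atTop 0] with t ht
  calc tail P (fun ω => c * V ω) t ≤ tail P V (t * (c + 1)⁻¹) := by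
        refine measureReal_mono fun ω (hω : t < c * V ω) => ?_
        simp only [Set.mem_ofPred_eq]
        rw [← div_eq_mul_inv, div_lt_iff₀ hc1]
        nlinarith [H.V_nonneg ω]
    _ ≤ C * (D * tail P A t) := (h _).trans (mul_le_mul_of_nonneg_left (hDt t) hC)
    _ = _ := by ring

/-- Since φ(x) ≤ εx + D, the map is dominated by the affine recursion with M = |A| + εV and N = DV.
A bounded start satisfies the tail bound trivially, and the recursion preserves it. -/
theorem exists_iterate_tail_bound (H : Model P Ψ A V φ α ν) (μ : Measure ℝ)
    [IsProbabilityMeasure μ] (hμ : μ ≪ ν) {K : ℝ} (hK : ∀ᵐ r ∂μ, |r| ≤ K) :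
    ∃ c : ℝ, 0 ≤ c ∧ ∀ n t, tail ((step P Ψ)^[n] μ) (fun r => |r|) t ≤ c * tail P A t := by
  obtain ⟨ε, hε, hint, hlt⟩ := exists_pos_integral_add_lt_one H.heavy.pos H.heavy.meas H.measV
    H.abs_le H.integrable_V H.moment
  obtain ⟨D, hD, hφ⟩ := H.phi_le ε hε
  obtain ⟨C₁, hC₁, h₁⟩ := H.tail_const_mul_V_le (add_nonneg zero_le_one hε.le)
  obtain ⟨C₂, hC₂, h₂⟩ := H.tail_const_mul_V_le hD
  have hp : ∀ n, IsProbabilityMeasure ((step P Ψ)^[n] μ) := fun n =>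
    isProbabilityMeasure_iterate_step H.measΨ H.cont μ n
  have hac : ∀ n, (step P Ψ)^[n] μ ≪ ν := by
    intro n
    induction n with
    | zero => exact hμ
    | succ n ih =>
      rw [Function.iterate_succ_apply']
      have := hp n
      have h3 := step_absolutelyContinuous (P := P) H.measΨ H.cont ih
      rwa [H.stationary] at h3
  obtain ⟨c₀, -, h0⟩ := H.heavy.regVar.exists_global_bound (g := tail μ fun r => |r|)
    (fun t => tail_le_one _ _ _) (C := 0) (by
      filter_upwards [eventually_ge_atTop K] with t ht
      rw [zero_mul, tail, measureReal_def]
      have : μ {r | t < |r|} = 0 := by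
        rw [measure_eq_zero_iff_ae_notMem]
        filter_upwards [hK] with r hr h
        exact absurd (lt_of_lt_of_le h hr) (not_lt.2 ht)
      rw [this, ENNReal.toReal_zero])
  have hMm : Measurable fun ω => |A ω| + ε * V ω := H.heavy.meas.abs.add (H.measV.const_mul ε)
  have hNm : Measurable fun ω => D * V ω := H.measV.const_mul D
  refine exists_uniform_tail_bound H.heavy (M := fun ω => |A ω| + ε * V ω) (N := fun ω => D * V ω)
    hMm hNm
    (fun ω => add_nonneg (abs_nonneg _) (mul_nonneg hε.le (H.V_nonneg ω))) hint hlt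
    (C := max C₁ C₂) (hC₁.trans (le_max_left _ _)) (fun t => ?_) (fun t => ?_)
    (fun n => (step P Ψ)^[n] μ) h0 fun n t => ?_
  · refine le_trans (measureReal_mono fun ω (hω : t < |A ω| + ε * V ω) => ?_) ((h₁ t).trans
      (mul_le_mul_of_nonneg_right (le_max_left _ _) (tail_nonneg _ _ _)))
    simp only [Set.mem_ofPred_eq]
    linarith [H.abs_le ω]
  · exact (h₂ t).trans (mul_le_mul_of_nonneg_right (le_max_right _ _) (tail_nonneg _ _ _))
  · have := hp n
    set κ := (step P Ψ)^[n] μ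
    have hmS : MeasurableSet {p : Ω × ℝ | t < (|A p.1| + ε * V p.1) * |p.2| + D * V p.1} := by
      have h2 := H.measV
      have h3 := H.heavy.meas
      exact measurableSet_lt measurable_const (by fun_prop)
    simp only [Function.iterate_succ_apply']
    rw [tail, step, measureReal_def, Measure.map_apply H.measurable_eval
      (measurableSet_lt measurable_const (by fun_prop)), ← measureReal_def, ← real_prod_swap hmS]
    refine real_mono_of_ae ?_
    filter_upwards [H.ae_abs_rem_le (hac n) (g := fun r => ε * |r| + D) (by fun_prop)
      fun r => hφ _ (abs_nonneg r)] with p hp hlt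
    simp only [Set.preimage, Set.mem_ofPred_eq, Prod.fst_swap, Prod.snd_swap] at hlt ⊢
    have h5 : t < |Ψ p.2 p.1| := hlt
    have h4 : |Ψ p.2 p.1| ≤ |Ψ p.2 p.1 - A p.2 * p.1| + |A p.2| * |p.1| := by
      rw [← abs_mul]
      simpa using abs_add_le (Ψ p.2 p.1 - A p.2 * p.1) (A p.2 * p.1)
    show t < (|A p.2| + ε * V p.2) * |p.1| + D * V p.2
    linarith

/-- The iterates of `ν` conditioned on a bounded set share one tail bound and converge weakly to
`ν`; the portmanteau inequality for the open set |r| > t carries the bound over. -/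
theorem exists_tail_bound (H : Model P Ψ A V φ α ν)
    (hlim : ∀ μ : ProbabilityMeasure ℝ,
      Tendsto (iterLaw P H.measΨ H.cont μ) atTop (𝓝 ⟨ν, inferInstance⟩)) :
    ∃ c : ℝ, 0 ≤ c ∧ ∀ t, tail ν (fun r => |r|) t ≤ c * tail P A t := by
  obtain ⟨K, hK⟩ : ∃ K : ℕ, ν {r | |r| ≤ K} ≠ 0 := by
    by_contra! h
    have h1 : ν (⋃ K : ℕ, {r : ℝ | |r| ≤ K}) = 0 := measure_iUnion_null h
    have h2 : (⋃ K : ℕ, {r : ℝ | |r| ≤ K}) = Set.univ := by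
      ext r; simpa using exists_nat_ge |r|
    rw [h2, measure_univ] at h1
    exact one_ne_zero h1
  have hms : MeasurableSet {r : ℝ | |r| ≤ K} := measurableSet_le (by fun_prop) measurable_const
  have hprob : IsProbabilityMeasure (ProbabilityTheory.cond ν {r | |r| ≤ K}) :=
    cond_isProbabilityMeasure hK
  obtain ⟨c, hc, h⟩ := H.exists_iterate_tail_bound (ProbabilityTheory.cond ν {r | |r| ≤ K})
    cond_absolutelyContinuous (K := K) (ae_cond_mem hms)
  refine ⟨c, hc, fun t => ?_⟩
  have hopen : IsOpen {r : ℝ | t < |r|} := isOpen_lt continuous_const continuous_abs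
  have h1 := ProbabilityMeasure.le_liminf_measure_open_of_tendsto (hlim ⟨_, hprob⟩) hopen
  have h2 : ν {r : ℝ | t < |r|} ≤ ENNReal.ofReal (c * tail P A t) := by
    refine h1.trans (liminf_le_of_frequently_le' (Frequently.of_forall fun n => ?_))
    have := isProbabilityMeasure_iterate_step (P := P) H.measΨ H.cont
      (ProbabilityTheory.cond ν {r | |r| ≤ K}) n
    have h3 := h n t
    rw [tail, measureReal_def] at h3
    exact (ENNReal.le_ofReal_iff_toReal_le (measure_ne_top _ _)
      (mul_nonneg hc (tail_nonneg _ _ _))).2 h3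
  rw [tail, measureReal_def]
  exact ENNReal.toReal_le_of_le_ofReal (mul_nonneg hc (tail_nonneg _ _ _)) h2

end Model

end IFS

/-! ### Lower bounds for monotone maps -/

namespace IFS

namespace Model

variable {Ω : Type*} [MeasurableSpace Ω] {P : Measure Ω} [IsProbabilityMeasure P]
  {Ψ : Ω → ℝ → ℝ} {A V : Ω → ℝ} {φ : ℝ → ℝ} {α : ℝ} {ν : Measure ℝ} [IsProbabilityMeasure ν]

theorem real_preimage (H : Model P Ψ A V φ α ν) {S : Set ℝ} (hS : MeasurableSet S) :
    ν.real S = (ν.prod P).real {p | Ψ p.2 p.1 ∈ S} := by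
  conv_lhs => rw [← H.stationary]
  rw [step, measureReal_def, Measure.map_apply H.measurable_eval hS]
  rfl

theorem mul_le_tail_abs (H : Model P Ψ A V φ α ν) {S : Set ℝ} {E : Set Ω} {t : ℝ}
    (h : ∀ᵐ ω ∂P, ∀ r ∈ S, ω ∈ E → t < |Ψ ω r|) :
    ν.real S * P.real E ≤ tail ν (fun r => |r|) t := by
  rw [tail, H.real_preimage (measurableSet_lt measurable_const (by fun_prop)), measureReal_def,
    measureReal_def, ← ENNReal.toReal_mul, ← Measure.prod_prod, ← measureReal_def]
  refine real_mono_of_ae ?_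
  filter_upwards [measurePreserving_snd.quasiMeasurePreserving.ae h] with p hp hpS
  exact hp p.1 hpS.1 hpS.2

/-- If A > 2t and Φ(1) ≥ -t, then Ψ(1) = A + Φ(1) > t, and monotonicity gives Ψ(R) > t for every R ≥
1. -/
theorem lower_bound_of_one_le (H : Model P Ψ A V φ α ν) (hmono : ∀ᵐ ω ∂P, Monotone (Ψ ω))
    (ho : (fun t => P.real {ω | t < A ω ∧ rem Ψ A ω 1 < -t}) =o[atTop] tail P A)
    (h1 : 0 < ν {r | 1 ≤ r}) :
    ∃ c : ℝ, 0 < c ∧ ∀ᶠ t in atTop, c * tail P A t ≤ tail ν (fun r => |r|) t := by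
  have hq : 0 < ν.real {r | 1 ≤ r} := ENNReal.toReal_pos h1.ne' (measure_ne_top _ _)
  have h2 : (0 : ℝ) < 2 ^ (-α) := by positivity
  refine ⟨ν.real {r | 1 ≤ r} * (2 ^ (-α) / 4), by positivity, ?_⟩
  filter_upwards [H.heavy.regVar.eventually_ge two_pos (half_lt_self h2),
    ho.bound (show 0 < (2 : ℝ) ^ (-α) / 4 by positivity), eventually_ge_atTop 0]
    with t ht1 ht2 ht0
  rw [Real.norm_of_nonneg measureReal_nonneg, Real.norm_of_nonneg (tail_nonneg _ _ _)] at ht2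
  have h3 : tail P A (t * 2) ≤ P.real {ω | t < Ψ ω 1}
      + P.real {ω | t < A ω ∧ rem Ψ A ω 1 < -t} := by
    refine (measureReal_mono fun ω (hω : t * 2 < A ω) => ?_).trans (measureReal_union_le _ _)
    by_cases h : rem Ψ A ω 1 < -t
    · exact Or.inr ⟨by linarith, h⟩
    · refine Or.inl ?_
      simp only [rem, Set.mem_ofPred_eq] at h ⊢
      linarith
  have h4 : 2 ^ (-α) / 4 * tail P A t ≤ P.real {ω | t < Ψ ω 1} := by linarith
  refine le_trans ?_ (H.mul_le_tail_abs (S := {r | 1 ≤ r}) (E := {ω | t < Ψ ω 1}) ?_)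
  · rw [mul_assoc]; exact mul_le_mul_of_nonneg_left h4 hq.le
  · filter_upwards [hmono] with ω hω r hr hE
    exact (lt_of_lt_of_le hE (hω hr)).trans_le (le_abs_self _)

/-- Fix a very negative x and put s = t/(-x). If A > 2s while V ≤ s/ε, the term Ax < -2t dominates
the error, which is at most t, so Ψ(x) < -t and likewise Ψ(R) < -t for R < x. -/
theorem lower_bound_of_unbounded_below (H : Model P Ψ A V φ α ν)
    (hmono : ∀ᵐ ω ∂P, Monotone (Ψ ω)) (h1 : ∀ K : ℝ, 0 < ν {r | r < -K}) :
    ∃ c : ℝ, 0 < c ∧ ∀ᶠ t in atTop, c * tail P A t ≤ tail ν (fun r => |r|) t := by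
  have hα := H.heavy.pos
  have hF := H.heavy.regVar
  obtain ⟨C, hC, hV⟩ := H.tail_le
  have h2 : (0 : ℝ) < 2 ^ (-α) := by positivity
  -- ε is chosen so that the exceptional event V > s/ε takes at most half of the lower bound
  -- (2^{-α}/2) P[A > s] for P[A > 2s].
  obtain ⟨ε, hεα, hε⟩ : ∃ ε : ℝ, C * (2 * ε ^ α) < 2 ^ (-α) / 4 ∧ 0 < ε := by
    have hl : Tendsto (fun ε : ℝ => C * (2 * ε ^ α)) (𝓝[>] 0) (𝓝 0) := by
      have h3 : ContinuousAt (fun ε : ℝ => C * (2 * ε ^ α)) 0 := by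
        have := Real.continuousAt_rpow_const 0 α (Or.inr hα.le)
        fun_prop
      have h4 := h3.tendsto
      simp only [Real.zero_rpow hα.ne', mul_zero] at h4
      exact h4.mono_left nhdsWithin_le_nhds
    exact ((hl.eventually (gt_mem_nhds (by positivity))).and self_mem_nhdsWithin).exists
  obtain ⟨D, hD, hφ⟩ := H.phi_le (ε / 2) (by positivity)
  -- Beyond 2D/ε the constant D is at most (ε/2)|x|, hence φ(|x|) ≤ ε|x|.
  obtain ⟨x, hx, hxr⟩ : ∃ x : ℝ, x < -(2 * D / ε + 1) ∧
      ∀ᵐ ω ∂P, |rem Ψ A ω x| ≤ V ω * φ |x| := by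
    have h3 : ∃ᶠ r in ae ν, r < -(2 * D / ε + 1) := frequently_ae_iff.2 (h1 _).ne'
    exact (h3.and_eventually H.approx).exists
  have hD' : 0 ≤ 2 * D / ε := by positivity
  have hx0 : 0 < -x := by linarith
  have hφx : φ |x| ≤ ε * -x := by
    have h3 := hφ |x| (abs_nonneg x)
    rw [abs_of_neg (by linarith : x < 0)] at h3 ⊢
    have h4 : 2 * D / ε ≤ -x := by linarith
    rw [div_le_iff₀ hε] at h4
    nlinarith
  have hq : 0 < ν.real {r | r < x} := by
    have := h1 (-x)
    rw [neg_neg] at this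
    exact ENNReal.toReal_pos this.ne' (measure_ne_top _ _)
  have hxα : 0 < (-x) ^ α := by positivity
  refine ⟨ν.real {r | r < x} * (2 ^ (-α) / 4 * ((-x) ^ α / 2)), by positivity, ?_⟩
  have hscale : Tendsto (fun t : ℝ => t / -x) atTop atTop := tendsto_id.atTop_div_const hx0
  have hev2 := hscale.eventually (hF.eventually_ge two_pos (half_lt_self h2))
  have hev3 : ∀ᶠ s in atTop, tail P A (s / ε) ≤ 2 * ε ^ α * tail P A s := by
    have hεα0 : 0 < ε ^ α := by positivity
    filter_upwards [(hF.tendsto_div hε).eventually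
      (gt_mem_nhds (show ε ^ α < 2 * ε ^ α by linarith))] with s hs
    exact ((div_lt_iff₀ (hF.pos s)).1 hs).le
  have hev4 : ∀ᶠ t in atTop, (-x) ^ α / 2 * tail P A t ≤ tail P A (t / -x) := by
    filter_upwards [(hF.tendsto_div hx0).eventually (lt_mem_nhds (half_lt_self hxα))] with t ht
    exact ((lt_div_iff₀ (hF.pos t)).1 ht).le
  filter_upwards [hev2, hscale.eventually hev3, hev4] with t ht2 ht3 ht4
  set s := t / -x with hs
  have hts : t = -x * s := by rw [hs, mul_div_cancel₀ _ hx0.ne']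
  have h3 : tail P A (s * 2) ≤ P.real {ω | Ψ ω x < -t} + tail P V (s / ε) := by
    refine le_trans (real_mono_of_ae (t := {ω | Ψ ω x < -t} ∪ {ω | s / ε < V ω}) ?_)
      (measureReal_union_le _ _)
    filter_upwards [hxr] with ω hω hA
    by_cases h : s / ε < V ω
    · exact Or.inr h
    · refine Or.inl ?_
      rw [not_lt, le_div_iff₀ hε] at h
      have hA' : s * 2 < A ω := hA
      have h4 : Ψ ω x - A ω * x ≤ V ω * (ε * -x) :=
        ((le_abs_self _).trans hω).trans (mul_le_mul_of_nonneg_left hφx (H.V_nonneg ω))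
      simp only [Set.mem_ofPred_eq]
      rw [hts]
      nlinarith
  have h4 : 2 ^ (-α) / 4 * tail P A s ≤ P.real {ω | Ψ ω x < -t} := by
    have h5 := hV (s / ε)
    have h6 := mul_le_mul_of_nonneg_left ht3 hC
    have h7 := mul_le_mul_of_nonneg_right hεα.le (hF.pos s).le
    linarith
  refine le_trans ?_ (H.mul_le_tail_abs (S := {r | r < x}) (E := {ω | Ψ ω x < -t}) ?_)
  · rw [mul_assoc, mul_assoc]
    exact mul_le_mul_of_nonneg_left
      ((mul_le_mul_of_nonneg_left ht4 (by positivity)).trans h4) hq.le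
  · filter_upwards [hmono] with ω hω r hr hE
    have h5 : Ψ ω r ≤ Ψ ω x := hω (le_of_lt hr)
    have h6 : Ψ ω x < -t := hE
    exact (by linarith : t < -Ψ ω r).trans_le (neg_le_abs _)

end Model

end IFS

/-! ### Splitting a large value of Ψ(R) according to its cause -/

namespace IFS

namespace Model

variable {Ω : Type*} [MeasurableSpace Ω] {P : Measure Ω} [IsProbabilityMeasure P]
  {Ψ : Ω → ℝ → ℝ} {A V : Ω → ℝ} {φ : ℝ → ℝ} {α : ℝ} {ν : Measure ℝ} [IsProbabilityMeasure ν]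
  {σ : ℝ} {f : ℝ → ℝ}

theorem measurableSet_lt_eval (H : Model P Ψ A V φ α ν) (σ t : ℝ) :
    MeasurableSet {p : ℝ × Ω | t < σ * Ψ p.2 p.1} :=
  measurableSet_lt measurable_const (H.measurable_eval.const_mul σ)

theorem tail_eq (H : Model P Ψ A V φ α ν) (σ t : ℝ) :
    tail ν (fun r => σ * r) t = (ν.prod P).real {p | t < σ * Ψ p.2 p.1} :=
  H.real_preimage (measurableSet_lt measurable_const (measurable_id.const_mul σ))

theorem tail_eq_integral (H : Model P Ψ A V φ α ν) (σ t : ℝ) :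
    tail ν (fun r => σ * r) t = ∫ r, P.real {ω | t < σ * Ψ ω r} ∂ν := by
  rw [H.tail_eq, real_prod_eq_integral (H.measurableSet_lt_eval σ t)]
  rfl

/-- Fatou along the integers: the integrals of the quotients equal the tail ratios of σR, which the
upper bound keeps below c. -/
theorem integrable_of_tendsto (H : Model P Ψ A V φ α ν) {c : ℝ}
    (hc : ∀ t, tail ν (fun r => σ * r) t ≤ c * tail P A t) (hf : Measurable f)
    (hf0 : ∀ y, 0 ≤ f y)
    (hlim : ∀ᵐ y ∂ν, Tendsto (fun t => P.real {ω | t < σ * Ψ ω y} / tail P A t) atTop (𝓝 (f y))) :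
    Integrable f ν := by
  refine ⟨hf.aestronglyMeasurable, ?_⟩
  rw [hasFiniteIntegral_iff_ofReal (ae_of_all _ hf0)]
  have hmeas : ∀ n : ℕ, Integrable
      (fun y => P.real {ω | (n : ℝ) < σ * Ψ ω y} / tail P A n) ν := fun n =>
    (integrable_real_slice (P := ν) (Q := P) (H.measurableSet_lt_eval σ n)).div_const _
  calc ∫⁻ y, ENNReal.ofReal (f y) ∂ν
      = ∫⁻ y, liminf (fun n : ℕ =>
          ENNReal.ofReal (P.real {ω | (n : ℝ) < σ * Ψ ω y} / tail P A n)) atTop ∂ν := by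
        refine lintegral_congr_ae ?_
        filter_upwards [hlim] with y hy
        exact ((ENNReal.continuous_ofReal.tendsto _).comp
          (hy.comp tendsto_natCast_atTop_atTop)).liminf_eq.symm
    _ ≤ liminf (fun n : ℕ => ∫⁻ y,
          ENNReal.ofReal (P.real {ω | (n : ℝ) < σ * Ψ ω y} / tail P A n) ∂ν) atTop :=
        lintegral_liminf_le' fun n => (hmeas n).1.aemeasurable.ennreal_ofReal
    _ ≤ ENNReal.ofReal c := by
        refine liminf_le_of_frequently_le' (Frequently.of_forall fun n => ?_)
        rw [← ofReal_integral_eq_lintegral_ofReal (hmeas n)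
          (ae_of_all _ fun y => div_nonneg measureReal_nonneg (tail_nonneg _ _ _)),
          integral_div, ← H.tail_eq_integral]
        exact ENNReal.ofReal_le_ofReal ((div_le_iff₀ (H.heavy.regVar.pos _)).2 (hc _))
    _ < ∞ := ENNReal.ofReal_lt_top

theorem measurableSet_abs_le (K : ℝ) : MeasurableSet {r : ℝ | |r| ≤ K} :=
  measurableSet_le (by fun_prop) measurable_const

theorem tendsto_compact_part (H : Model P Ψ A V φ α ν) (hσ : |σ| = 1)
    (hlim : ∀ᵐ y ∂ν, Tendsto (fun t => P.real {ω | t < σ * Ψ ω y} / tail P A t) atTop (𝓝 (f y)))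
    {K : ℝ} (hK : 0 ≤ K) :
    Tendsto (fun t => (ν.prod P).real {p | t < σ * Ψ p.2 p.1 ∧ |p.1| ≤ K} / tail P A t) atTop
      (𝓝 (∫ y in {r | |r| ≤ K}, f y ∂ν)) := by
  have heq : ∀ t, (ν.prod P).real {p | t < σ * Ψ p.2 p.1 ∧ |p.1| ≤ K}
      = ∫ y in {r | |r| ≤ K}, P.real {ω | t < σ * Ψ ω y} ∂ν := by
    intro t
    have hS : MeasurableSet {p : ℝ × Ω | t < σ * Ψ p.2 p.1 ∧ |p.1| ≤ K} :=
      (H.measurableSet_lt_eval σ t).inter (measurable_fst (measurableSet_abs_le K))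
    rw [real_prod_eq_integral hS, ← integral_indicator (measurableSet_abs_le K)]
    refine integral_congr_ae (ae_of_all _ fun y => ?_)
    by_cases h : |y| ≤ K
    · simp only
      rw [Set.indicator_of_mem (show y ∈ {r : ℝ | |r| ≤ K} from h)]
      congr 1
      ext ω; simp [h]
    · simp only
      rw [Set.indicator_of_notMem (show y ∉ {r : ℝ | |r| ≤ K} from h)]
      have : Prod.mk y ⁻¹' {p : ℝ × Ω | t < σ * Ψ p.2 p.1 ∧ |p.1| ≤ K} = ∅ := by
        ext ω; simp [h]
      exact (congrArg P.real this).trans measureReal_empty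
  simp_rw [heq, ← integral_div]
  obtain ⟨D, hD, hφ⟩ := H.phi_le 1 one_pos
  obtain ⟨C, hC, hV⟩ := H.tail_const_mul_V_le (show 0 ≤ K + (K + D) by positivity)
  refine tendsto_integral_filter_of_dominated_convergence (fun _ => C) ?_ ?_
    (integrable_const _) (ae_restrict_of_ae hlim)
  · exact Eventually.of_forall fun t => ((integrable_real_slice (P := ν) (Q := P)
      (H.measurableSet_lt_eval σ t)).div_const _).1.restrict
  · refine Eventually.of_forall fun t => ?_
    filter_upwards [ae_restrict_of_ae H.approx, ae_restrict_mem (measurableSet_abs_le K)]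
      with y hy hyK
    rw [Real.norm_of_nonneg (div_nonneg measureReal_nonneg (tail_nonneg _ _ _)),
      div_le_iff₀ (H.heavy.regVar.pos t)]
    refine le_trans (real_mono_of_ae ?_) (hV t)
    filter_upwards [hy] with ω hω h
    have hlt : t < σ * Ψ ω y := h
    have hyK' : |y| ≤ K := hyK
    have h1 : σ * Ψ ω y ≤ |Ψ ω y| := by
      refine (le_abs_self _).trans ?_
      rw [abs_mul, hσ, one_mul]
    have h2 : |Ψ ω y| ≤ |Ψ ω y - A ω * y| + |A ω| * |y| := by
      rw [← abs_mul]
      simpa using abs_add_le (Ψ ω y - A ω * y) (A ω * y)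
    have h3 : |Ψ ω y - A ω * y| ≤ V ω * (K + D) :=
      hω.trans (mul_le_mul_of_nonneg_left
        ((hφ _ (abs_nonneg y)).trans (by linarith)) (H.V_nonneg ω))
    have h4 : |A ω| * |y| ≤ V ω * K :=
      mul_le_mul (H.abs_le ω) hyK' (abs_nonneg _) (H.V_nonneg ω)
    show t < (K + (K + D)) * V ω
    nlinarith

/-- The event that `σ A R` exceeds `t` while `|A| ≤ K`. -/
def linSet (A : Ω → ℝ) (σ K t : ℝ) : Set (Ω × ℝ) := {p | t < σ * (A p.1 * p.2) ∧ |A p.1| ≤ K}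

theorem measurableSet_linSet (hA : Measurable A) (σ K t : ℝ) : MeasurableSet (linSet A σ K t) := by
  have h1 : Measurable fun p : Ω × ℝ => σ * (A p.1 * p.2) := by fun_prop
  have h2 : Measurable fun p : Ω × ℝ => |A p.1| := (hA.comp measurable_fst).abs
  exact (measurableSet_lt measurable_const h1).inter (measurableSet_le h2 measurable_const)

/-- The product V|R| has tail O(P[A > t]), so its probability of exceeding tz is of order z^{-α} P[A
> t]. Taking z large and ε = η/z makes this small. -/
theorem exists_error_le (H : Model P Ψ A V φ α ν) {c : ℝ} (hc : 0 ≤ c)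
    (hν : ∀ t, tail ν (fun r => |r|) t ≤ c * tail P A t) {η δ : ℝ} (hη : 0 < η) (hδ : 0 < δ) :
    ∃ ε : ℝ, 0 < ε ∧ ∀ᶠ t in atTop,
      (P.prod ν).real {p | η * t < V p.1 * (ε * |p.2|)} ≤ δ * tail P A t := by
  obtain ⟨C, hC, hV⟩ := H.tail_le
  obtain ⟨D, hD, h⟩ := exists_tail_mul_le (P₂ := ν) H.heavy.regVar H.heavy.meas H.heavy.big H.measV
    (Y := fun r => |r|) (by fun_prop) H.V_nonneg hC hc hV hν
  obtain ⟨z, hz, hz0⟩ := (((tendsto_rpow_neg_atTop H.heavy.pos).eventually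
    (gt_mem_nhds (show 0 < δ / (D + 1) by positivity))).and (eventually_gt_atTop 0)).exists
  refine ⟨η / z, by positivity, ?_⟩
  filter_upwards [H.heavy.regVar.eventually_le hz0 hz] with t ht
  have h1 : {p : Ω × ℝ | η * t < V p.1 * (η / z * |p.2|)} ⊆ {p | t * z < V p.1 * |p.2|} := by
    intro p (hp : η * t < V p.1 * (η / z * |p.2|))
    show t * z < V p.1 * |p.2|
    have h2 : V p.1 * (η / z * |p.2|) = η * (V p.1 * |p.2| / z) := by ring
    rw [h2] at hp
    exact (lt_div_iff₀ hz0).1 (lt_of_mul_lt_mul_left hp hη.le)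
  calc _ ≤ _ := (measureReal_mono h1).trans (h (t * z))
    _ ≤ D * (δ / (D + 1) * tail P A t) := mul_le_mul_of_nonneg_left ht hD
    _ = (D / (D + 1)) * (δ * tail P A t) := by ring
    _ ≤ 1 * (δ * tail P A t) := by
        refine mul_le_mul_of_nonneg_right ?_ (mul_nonneg hδ.le (tail_nonneg _ _ _))
        rw [div_le_one (by positivity)]; linarith
    _ = _ := one_mul _

theorem eventually_big_le (H : Model P Ψ A V φ α ν) {c : ℝ} (hc : 0 ≤ c)
    (hν : ∀ t, tail ν (fun r => |r|) t ≤ c * tail P A t) {y δ : ℝ} (hy : 0 < y) (hδ : 0 < δ) :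
    ∀ᶠ K in atTop, ∀ᶠ t in atTop,
      (P.prod ν).real (bigSet (fun ω => |A ω|) (fun r => |r|) K (t * y)) ≤ δ * tail P A t := by
  obtain ⟨C, hC, hV⟩ := H.tail_le
  obtain ⟨D, hD, hDt⟩ := H.heavy.regVar.exists_dilation_bound hy
  have hAt : ∀ t, tail P (fun ω => |A ω|) t ≤ C * tail P A t := fun t =>
    (measureReal_mono fun ω (hω : t < |A ω|) => hω.trans_le (H.abs_le ω)).trans (hV t)
  filter_upwards [H.heavy.big (δ / (C * c * D + 1)) (by positivity), eventually_ge_atTop 0]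
    with K hK hK0
  filter_upwards [(tendsto_id.atTop_mul_const hy).eventually hK] with t ht
  simp only [id] at ht
  calc _ ≤ C * c * (P.prod P).real (bigSet A A K (t * y)) :=
        real_bigSet_le_self H.heavy.meas H.heavy.meas.abs (by fun_prop) hK0 hC hAt hν
    _ ≤ C * c * (δ / (C * c * D + 1) * (D * tail P A t)) := by
        gcongr
        exact ht.trans (by gcongr; exact hDt t)
    _ = (C * c * D / (C * c * D + 1)) * (δ * tail P A t) := by ring
    _ ≤ 1 * (δ * tail P A t) := by
        refine mul_le_mul_of_nonneg_right ?_ (mul_nonneg hδ.le (tail_nonneg _ _ _))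
        rw [div_le_one (by positivity)]; linarith
    _ = _ := one_mul _

/-- For |R| > K, replacing Ψ(R) by AR costs at most εV|R|, which is below ηt off a negligible event;
this explains the levels t(1 ± η). Both |A| and |R| exceeding K is negligible too, so only bounded
|R| or bounded |A| remains. -/
theorem eventually_sandwich (H : Model P Ψ A V φ α ν) (hσ : |σ| = 1) {c : ℝ} (hc : 0 ≤ c)
    (hν : ∀ t, tail ν (fun r => |r|) t ≤ c * tail P A t) {η δ : ℝ} (hη : 0 < η) (hη1 : η < 1)
    (hδ : 0 < δ) :
    ∀ᶠ K in atTop, ∀ᶠ t in atTop,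
      tail ν (fun r => σ * r) t ≤ (ν.prod P).real {p | t < σ * Ψ p.2 p.1 ∧ |p.1| ≤ K}
        + (P.prod ν).real (linSet A σ K (t * (1 - η))) + δ * tail P A t ∧
      (ν.prod P).real {p | t < σ * Ψ p.2 p.1 ∧ |p.1| ≤ K}
        + (P.prod ν).real (linSet A σ K (t * (1 + η))) ≤
        tail ν (fun r => σ * r) t + δ * tail P A t := by
  obtain ⟨ε, hε, herr⟩ := H.exists_error_le hc hν hη (half_pos hδ)
  obtain ⟨D, hD, hφ⟩ := H.phi_le (ε / 2) (by positivity)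
  filter_upwards [H.eventually_big_le hc hν (sub_pos.2 hη1) (half_pos hδ),
    eventually_ge_atTop (2 * D / ε), eventually_gt_atTop 0] with K hK hKD hK0
  have hφK : ∀ r : ℝ, K < |r| → φ |r| ≤ ε * |r| := by
    intro r hr
    have h1 : 2 * D / ε ≤ |r| := hKD.trans hr.le
    rw [div_le_iff₀ hε] at h1
    have := hφ |r| (abs_nonneg r)
    nlinarith
  have hae : ∀ᵐ p ∂(ν.prod P), K < |p.1| →
      |σ * Ψ p.2 p.1 - σ * (A p.2 * p.1)| ≤ V p.2 * (ε * |p.1|) := by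
    have hm : MeasurableSet {p : ℝ × Ω | K < |p.1| →
        |σ * Ψ p.2 p.1 - σ * (A p.2 * p.1)| ≤ V p.2 * (ε * |p.1|)} := by
      have h1 := H.measurable_eval
      have h2 := H.measV
      have h3 := H.heavy.meas
      have h4 : Measurable fun p : ℝ × Ω => σ * Ψ p.2 p.1 - σ * (A p.2 * p.1) :=
        (h1.const_mul σ).sub (by fun_prop)
      exact (measurableSet_lt (measurable_const (a := K))
        (by fun_prop : Measurable fun p : ℝ × Ω => |p.1|)).imp
        (measurableSet_le h4.abs (by fun_prop))
    refine (Measure.ae_prod_mem_iff_ae_ae_mem hm).2 ?_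
    filter_upwards [H.approx] with r hr
    filter_upwards [hr] with ω hω hK
    rw [← mul_sub, abs_mul, hσ, one_mul]
    exact hω.trans (mul_le_mul_of_nonneg_left (hφK r hK) (H.V_nonneg ω))
  have hA := H.heavy.meas
  have hV := H.measV
  filter_upwards [herr, hK, eventually_gt_atTop (K * K)] with t h1 h2 ht
  have ht0 : 0 < t := (mul_pos hK0 hK0).trans ht
  have hm1 : MeasurableSet {p : Ω × ℝ | η * t < V p.1 * (ε * |p.2|)} :=
    measurableSet_lt measurable_const (by fun_prop)
  have hm2 := measurableSet_bigSet (X := fun ω => |A ω|) (Y := fun r : ℝ => |r|) hA.abs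
    (by fun_prop) K (t * (1 - η))
  have hm3 := measurableSet_linSet (Ω := Ω) hA σ K (t * (1 - η))
  have hm4 := measurableSet_linSet (Ω := Ω) hA σ K (t * (1 + η))
  rw [← real_prod_swap hm1] at h1
  rw [← real_prod_swap hm2] at h2
  rw [H.tail_eq, ← real_prod_swap hm3, ← real_prod_swap hm4]
  constructor
  · have h5 : (ν.prod P).real {p | t < σ * Ψ p.2 p.1} ≤ (ν.prod P).real
        ({p : ℝ × Ω | t < σ * Ψ p.2 p.1 ∧ |p.1| ≤ K} ∪ Prod.swap ⁻¹' linSet A σ K (t * (1 - η))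
          ∪ Prod.swap ⁻¹' bigSet (fun ω => |A ω|) (fun r => |r|) K (t * (1 - η))
          ∪ Prod.swap ⁻¹' {p : Ω × ℝ | η * t < V p.1 * (ε * |p.2|)}) := by
      refine real_mono_of_ae ?_
      filter_upwards [hae] with p hp hlt
      have hlt' : t < σ * Ψ p.2 p.1 := hlt
      by_cases hr : |p.1| ≤ K
      · exact Or.inl (Or.inl (Or.inl ⟨hlt', hr⟩))
      have hp' := hp (not_le.1 hr)
      by_cases he : η * t < V p.2 * (ε * |p.1|)
      · exact Or.inr he
      have h6 : t * (1 - η) < σ * (A p.2 * p.1) := by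
        have := (le_abs_self _).trans hp'
        nlinarith
      by_cases ha : |A p.2| ≤ K
      · exact Or.inl (Or.inl (Or.inr ⟨h6, ha⟩))
      · refine Or.inl (Or.inr ⟨?_, not_le.1 ha, not_le.1 hr⟩)
        have h7 : σ * (A p.2 * p.1) ≤ |A p.2| * |p.1| := by
          refine (le_abs_self _).trans ?_
          rw [abs_mul, hσ, one_mul, abs_mul]
        exact h6.trans_le h7
    refine h5.trans ((measureReal_union_le _ _).trans ?_)
    have h6 := measureReal_union_le (μ := ν.prod P)
      ({p : ℝ × Ω | t < σ * Ψ p.2 p.1 ∧ |p.1| ≤ K} ∪ Prod.swap ⁻¹' linSet A σ K (t * (1 - η)))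
      (Prod.swap ⁻¹' bigSet (fun ω => |A ω|) (fun r => |r|) K (t * (1 - η)))
    have h7 := measureReal_union_le (μ := ν.prod P)
      {p : ℝ × Ω | t < σ * Ψ p.2 p.1 ∧ |p.1| ≤ K} (Prod.swap ⁻¹' linSet A σ K (t * (1 - η)))
    linarith
  · have hms : MeasurableSet {p : ℝ × Ω | t < σ * Ψ p.2 p.1 ∧ K < |p.1|} :=
      (H.measurableSet_lt_eval σ t).inter
        (measurable_fst (measurableSet_lt measurable_const
          (by fun_prop : Measurable fun r : ℝ => |r|)))
    have hsplit : (ν.prod P).real {p | t < σ * Ψ p.2 p.1}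
        = (ν.prod P).real {p | t < σ * Ψ p.2 p.1 ∧ |p.1| ≤ K}
          + (ν.prod P).real {p | t < σ * Ψ p.2 p.1 ∧ K < |p.1|} := by
      rw [← measureReal_union _ hms]
      · congr 1
        ext p
        simp only [Set.mem_ofPred_eq, Set.mem_union]
        rcases le_or_gt |p.1| K with h | h
        · simp [h, not_lt.2 h]
        · simp [h, not_le.2 h]
      · rw [Set.disjoint_left]
        rintro p ⟨-, h⟩ ⟨-, h'⟩
        exact absurd h (not_le.2 h')
    have h5 : (ν.prod P).real (Prod.swap ⁻¹' linSet A σ K (t * (1 + η))) ≤ (ν.prod P).real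
        ({p : ℝ × Ω | t < σ * Ψ p.2 p.1 ∧ K < |p.1|}
          ∪ Prod.swap ⁻¹' {p : Ω × ℝ | η * t < V p.1 * (ε * |p.2|)}) := by
      refine real_mono_of_ae ?_
      filter_upwards [hae] with p hp hlt
      have h6 : t * (1 + η) < σ * (A p.2 * p.1) := hlt.1
      have h7 : |A p.2| ≤ K := hlt.2
      have h8 : σ * (A p.2 * p.1) ≤ |A p.2| * |p.1| := by
        refine (le_abs_self _).trans ?_
        rw [abs_mul, hσ, one_mul, abs_mul]
      -- With t > K² and |A| ≤ K, a product above t forces |R| > K. So the linear event is disjoint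
      -- from the part |R| ≤ K, and the two probabilities may be added in the lower bound.
      have hr : K < |p.1| := by
        by_contra h
        have := mul_le_mul h7 (not_lt.1 h) (abs_nonneg _) hK0.le
        nlinarith
      by_cases he : η * t < V p.2 * (ε * |p.1|)
      · exact Or.inr he
      · refine Or.inl ⟨?_, hr⟩
        have := (neg_le_abs _).trans (hp hr)
        nlinarith
    have h6 := h5.trans (measureReal_union_le _ _)
    have h7 : 0 ≤ δ / 2 * tail P A t := mul_nonneg (half_pos hδ).le (tail_nonneg _ _ _)
    linarith

end Model

end IFS

/-! ### Exact tail asymptotics by contraction of the error -/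

namespace IFS

theorem eventually_abs_setIntegral_tail_sub_le {Ω Ω₂ : Type*} [MeasurableSpace Ω]
    [MeasurableSpace Ω₂] {P : Measure Ω} {Q : Measure Ω₂} [IsProbabilityMeasure P]
    [IsProbabilityMeasure Q] {F : ℝ → ℝ} {α : ℝ} (hF : RegVar F α) {X : Ω → ℝ} {Y : Ω₂ → ℝ}
    (hX : Measurable X) {ℓ c K : ℝ}
    (h : ∀ᶠ t in atTop, |tail Q Y t - ℓ * F t| ≤ c * F t) :
    ∀ᶠ t in atTop, |∫ ω in {ω | 0 < X ω ∧ X ω ≤ K}, tail Q Y (t / X ω) ∂P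
      - ℓ * ∫ ω in {ω | 0 < X ω ∧ X ω ≤ K}, F (t / X ω) ∂P|
        ≤ c * ∫ ω in {ω | 0 < X ω ∧ X ω ≤ K}, F (t / X ω) ∂P := by
  obtain ⟨T, hT⟩ := eventually_atTop.1 h
  -- For 0 < X ≤ K this gives t/X ≥ T, so the asymptotic estimate applies at once under the whole
  -- integral.
  filter_upwards [eventually_ge_atTop (max T 0 * K)] with t ht
  have hY := (integrable_tail_div (P := P) (Q := Q) hX Y t).restrict
    (s := {ω | 0 < X ω ∧ X ω ≤ K})
  have hFi := (hF.integrable_comp_div (P := P) hX t).restrict (s := {ω | 0 < X ω ∧ X ω ≤ K})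
  rw [← integral_const_mul, ← integral_const_mul, ← integral_sub hY (hFi.const_mul ℓ)]
  refine (abs_integral_le_integral_abs).trans (integral_mono_ae (hY.sub (hFi.const_mul ℓ)).abs
    (hFi.const_mul c) ?_)
  filter_upwards [ae_restrict_mem (RegVar.measurableSet_Ioc hX K)] with ω hω
  refine hT _ ((le_max_left T 0).trans ?_)
  rw [le_div_iff₀ hω.1]
  exact (mul_le_mul_of_nonneg_left hω.2 (le_max_right _ _)).trans ht

namespace Model

variable {Ω : Type*} [MeasurableSpace Ω] {P : Measure Ω} [IsProbabilityMeasure P]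
  {Ψ : Ω → ℝ → ℝ} {A V : Ω → ℝ} {φ : ℝ → ℝ} {α : ℝ} {ν : Measure ℝ} [IsProbabilityMeasure ν]
  {σ : ℝ} {f : ℝ → ℝ}

/-- A negative A turns the tail of σR into that of -σR, which is how the two tails become coupled.
-/
theorem real_linSet (hA : Measurable A) (ν : Measure ℝ) [IsProbabilityMeasure ν] (σ K : ℝ) {t : ℝ}
    (ht : 0 < t) :
    (P.prod ν).real (linSet A σ K t)
      = ∫ ω in {ω | 0 < A ω ∧ A ω ≤ K}, tail ν (fun r => σ * r) (t / A ω) ∂P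
        + ∫ ω in {ω | 0 < -A ω ∧ -A ω ≤ K}, tail ν (fun r => -σ * r) (t / -A ω) ∂P := by
  have hm : ∀ s : ℝ, Measurable fun r : ℝ => s * r := fun s => measurable_id.const_mul s
  have hA' : Measurable fun ω => -A ω := hA.neg
  rw [← real_smallSet hA (hm σ), ← real_smallSet hA' (hm (-σ)),
    ← measureReal_union _ (measurableSet_smallSet hA' (hm (-σ)) K t)]
  · congr 1
    ext p
    simp only [linSet, smallSet, Set.mem_ofPred_eq, Set.mem_union]
    constructor
    · rintro ⟨h1, h2⟩
      rcases lt_trichotomy (A p.1) 0 with h | h | h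
      · rw [abs_of_neg h] at h2
        exact Or.inr ⟨by linarith, by linarith, h2⟩
      · rw [h] at h1; simp at h1; linarith
      · rw [abs_of_pos h] at h2
        exact Or.inl ⟨by linarith, h, h2⟩
    · rintro (⟨h1, h2, h3⟩ | ⟨h1, h2, h3⟩)
      · exact ⟨by linarith, by rwa [abs_of_pos h2]⟩
      · exact ⟨by linarith, by rwa [abs_of_neg (by linarith)]⟩
  · rw [Set.disjoint_left]
    rintro p ⟨-, h, -⟩ ⟨-, h', -⟩
    linarith

theorem integrable_posPart_rpow {X : Ω → ℝ} (H : Model P Ψ A V φ α ν) (hX : Measurable X)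
    (hXV : ∀ ω, X ω ≤ V ω) : Integrable (fun ω => max (X ω) 0 ^ α) P := by
  refine H.integrable_V.mono' ((hX.max measurable_const).pow_const α).aestronglyMeasurable
    (ae_of_all _ fun ω => ?_)
  rw [Real.norm_of_nonneg (by positivity)]
  exact Real.rpow_le_rpow (le_max_right _ _) (max_le (hXV ω) (H.V_nonneg ω)) H.heavy.pos.le

theorem integrable_negPart (H : Model P Ψ A V φ α ν) :
    Integrable (fun ω => max (-A ω) 0 ^ α) P :=
  H.integrable_posPart_rpow H.heavy.meas.neg fun ω => (neg_le_abs _).trans (H.abs_le ω)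

theorem integral_abs_rpow (H : Model P Ψ A V φ α ν) :
    ∫ ω, |A ω| ^ α ∂P = ∫ ω, max (A ω) 0 ^ α ∂P + ∫ ω, max (-A ω) 0 ^ α ∂P := by
  rw [← integral_add H.heavy.int H.integrable_negPart]
  refine integral_congr_ae (ae_of_all _ fun ω => ?_)
  have h0 := Real.zero_rpow H.heavy.pos.ne'
  rcases le_total 0 (A ω) with h | h
  · simp [max_eq_left h, max_eq_right (neg_nonpos.2 h), h0, abs_of_nonneg h]
  · simp [max_eq_right h, max_eq_left (neg_nonneg.2 h), h0, abs_of_nonpos h]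

/-- An error c in the tails of ±R is averaged against |A|^α on |A| ≤ K and comes out multiplied by
at most E|A|^α, the contraction factor. The other terms come from the dilation y and from
convergence in t. -/
theorem eventually_linSet (H : Model P Ψ A V φ α ν) {ℓ₁ ℓ₂ c y δ : ℝ} (hc : 0 ≤ c) (hy : 0 < y)
    (hδ : 0 < δ)
    (h₁ : ∀ᶠ t in atTop, |tail ν (fun r => σ * r) t - ℓ₁ * tail P A t| ≤ c * tail P A t)
    (h₂ : ∀ᶠ t in atTop, |tail ν (fun r => -σ * r) t - ℓ₂ * tail P A t| ≤ c * tail P A t)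
    {K : ℝ} (hK : 0 < K) :
    ∀ᶠ t in atTop, |(P.prod ν).real (linSet A σ K (t * y)) / tail P A t
      - (ℓ₁ * (∫ ω in {ω | 0 < A ω ∧ A ω ≤ K}, A ω ^ α ∂P)
        + ℓ₂ * ∫ ω in {ω | 0 < -A ω ∧ -A ω ≤ K}, (-A ω) ^ α ∂P)|
      ≤ y ^ (-α) * (c * ∫ ω, |A ω| ^ α ∂P) + |y ^ (-α) - 1| * (|ℓ₁| + |ℓ₂|) + δ := by
  have hA := H.heavy.meas
  have hF := H.heavy.regVar
  set a := ∫ ω in {ω | 0 < A ω ∧ A ω ≤ K}, A ω ^ α ∂P with ha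
  set b := ∫ ω in {ω | 0 < -A ω ∧ -A ω ≤ K}, (-A ω) ^ α ∂P with hb
  set I := fun t => (∫ ω in {ω | 0 < A ω ∧ A ω ≤ K}, tail P A (t / A ω) ∂P) with hI
  set J := fun t => (∫ ω in {ω | 0 < -A ω ∧ -A ω ≤ K}, tail P A (t / -A ω) ∂P) with hJ
  have hlimI : Tendsto (fun t => I t / tail P A t) atTop (𝓝 a) :=
    hF.tendsto_setIntegral_div hA hK
  have hlimJ : Tendsto (fun t => J t / tail P A t) atTop (𝓝 b) :=
    hF.tendsto_setIntegral_div (X := fun ω => -A ω) hA.neg hK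
  have ha0 : 0 ≤ a := setIntegral_nonneg (RegVar.measurableSet_Ioc hA K)
    fun ω hω => Real.rpow_nonneg hω.1.le _
  have hb0 : 0 ≤ b := setIntegral_nonneg (RegVar.measurableSet_Ioc (X := fun ω => -A ω) hA.neg K)
    fun ω hω => Real.rpow_nonneg hω.1.le _
  have hab : a + b ≤ ∫ ω, |A ω| ^ α ∂P := by
    rw [H.integral_abs_rpow]
    exact add_le_add (setIntegral_rpow_le hA H.heavy.int K)
      (setIntegral_rpow_le (X := fun ω => -A ω) hA.neg H.integrable_negPart K)
  have hab1 := H.moment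
  have hscale : Tendsto (fun t : ℝ => t * y) atTop atTop := tendsto_id.atTop_mul_const hy
  have hρ := hF.lim y hy
  have hy0 : 0 < y ^ (-α) := by positivity
  set L := ℓ₁ * a + ℓ₂ * b with hL
  have hLle : |L| ≤ |ℓ₁| + |ℓ₂| := by
    refine (abs_add_le _ _).trans (add_le_add ?_ ?_)
    · rw [abs_mul, abs_of_nonneg ha0]; exact mul_le_of_le_one_right (abs_nonneg _) (by linarith)
    · rw [abs_mul, abs_of_nonneg hb0]; exact mul_le_of_le_one_right (abs_nonneg _) (by linarith)
  have hbound : Tendsto (fun t => tail P A (t * y) / tail P A t *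
      (c * (I (t * y) / tail P A (t * y) + J (t * y) / tail P A (t * y))
        + |ℓ₁ * (I (t * y) / tail P A (t * y)) + ℓ₂ * (J (t * y) / tail P A (t * y)) - L|)
      + |tail P A (t * y) / tail P A t - 1| * |L|) atTop
      (𝓝 (y ^ (-α) * (c * (a + b) + |ℓ₁ * a + ℓ₂ * b - L|) + |y ^ (-α) - 1| * |L|)) := by
    have hI' := hlimI.comp hscale
    have hJ' := hlimJ.comp hscale
    exact (hρ.mul (((hI'.add hJ').const_mul c).add
      (((hI'.const_mul ℓ₁).add (hJ'.const_mul ℓ₂)).sub_const L).abs)).add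
      ((hρ.sub_const 1).abs.mul_const |L|)
  rw [← hL, sub_self, abs_zero, add_zero] at hbound
  have hlt : y ^ (-α) * (c * (a + b)) + |y ^ (-α) - 1| * |L|
      < y ^ (-α) * (c * ∫ ω, |A ω| ^ α ∂P) + |y ^ (-α) - 1| * (|ℓ₁| + |ℓ₂|) + δ := by
    have h3 : y ^ (-α) * (c * (a + b)) ≤ y ^ (-α) * (c * ∫ ω, |A ω| ^ α ∂P) := by gcongr
    have h4 : |y ^ (-α) - 1| * |L| ≤ |y ^ (-α) - 1| * (|ℓ₁| + |ℓ₂|) := by gcongr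
    linarith
  filter_upwards [hbound.eventually (gt_mem_nhds hlt),
    hscale.eventually (eventually_abs_setIntegral_tail_sub_le (P := P) hF hA (K := K) h₁),
    hscale.eventually (eventually_abs_setIntegral_tail_sub_le (P := P) hF (X := fun ω => -A ω)
      hA.neg (K := K) h₂), hscale.eventually (eventually_gt_atTop 0)] with t h3 h4 h5 h6
  refine le_trans ?_ h3.le
  rw [real_linSet hA ν σ K h6]
  set S := ∫ ω in {ω | 0 < A ω ∧ A ω ≤ K}, tail ν (fun r => σ * r) (t * y / A ω) ∂P
  set T := ∫ ω in {ω | 0 < -A ω ∧ -A ω ≤ K}, tail ν (fun r => -σ * r) (t * y / -A ω) ∂P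
  have hp := hF.pos t
  have hp' := hF.pos (t * y)
  set ρ := tail P A (t * y) / tail P A t with hρd
  have hρ0 : 0 ≤ ρ := by positivity
  have h4' : |S - ℓ₁ * I (t * y)| ≤ c * I (t * y) := h4
  have h5' : |T - ℓ₂ * J (t * y)| ≤ c * J (t * y) := h5
  have e1 : (S + T) / tail P A t = ρ * ((S + T) / tail P A (t * y)) := by
    rw [hρd]; field_simp
  have h7 : |(S + T) / tail P A (t * y) - (ℓ₁ * (I (t * y) / tail P A (t * y))
      + ℓ₂ * (J (t * y) / tail P A (t * y)))|
      ≤ c * (I (t * y) / tail P A (t * y) + J (t * y) / tail P A (t * y)) := by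
    have e2 : (S + T) / tail P A (t * y) - (ℓ₁ * (I (t * y) / tail P A (t * y))
        + ℓ₂ * (J (t * y) / tail P A (t * y)))
        = ((S - ℓ₁ * I (t * y)) + (T - ℓ₂ * J (t * y))) / tail P A (t * y) := by ring
    rw [e2, abs_div, abs_of_pos hp', ← add_div, ← mul_div_assoc]
    refine div_le_div_of_nonneg_right ((abs_add_le _ _).trans ?_) hp'.le
    linarith
  set W := ℓ₁ * (I (t * y) / tail P A (t * y)) + ℓ₂ * (J (t * y) / tail P A (t * y))
  set Z := (S + T) / tail P A (t * y)
  rw [e1]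
  have e3 : ρ * Z - L = ρ * ((Z - W) + (W - L)) + (ρ - 1) * L := by ring
  rw [e3]
  refine (abs_add_le _ _).trans ?_
  rw [abs_mul, abs_mul, abs_of_nonneg hρ0]
  refine add_le_add_left (mul_le_mul_of_nonneg_left ((abs_add_le _ _).trans ?_) hρ0) _
  exact add_le_add_left h7 _

/-- As K → ∞ and η → 0 the sandwich becomes the fixed-point equation for ℓ₁, except for the error
inherited from the tails of R. Five errors of size δ/5 arise: dilation by 1 ± η, the sandwich, the
linear part, the compact part and the choice of K. -/
theorem eventually_contraction (H : Model P Ψ A V φ α ν) (hσ : |σ| = 1) {C : ℝ} (hC : 0 ≤ C)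
    (hν : ∀ t, tail ν (fun r => |r|) t ≤ C * tail P A t)
    (hfint : Integrable f ν)
    (hlim : ∀ᵐ y ∂ν, Tendsto (fun t => P.real {ω | t < σ * Ψ ω y} / tail P A t) atTop (𝓝 (f y)))
    {ℓ₁ ℓ₂ c δ : ℝ} (hc : 0 ≤ c) (hδ : 0 < δ)
    (hℓ : ℓ₁ = (∫ y, f y ∂ν) + (∫ ω, max (A ω) 0 ^ α ∂P) * ℓ₁ + (∫ ω, max (-A ω) 0 ^ α ∂P) * ℓ₂)
    (h₁ : ∀ᶠ t in atTop, |tail ν (fun r => σ * r) t - ℓ₁ * tail P A t| ≤ c * tail P A t)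
    (h₂ : ∀ᶠ t in atTop, |tail ν (fun r => -σ * r) t - ℓ₂ * tail P A t| ≤ c * tail P A t) :
    ∀ᶠ t in atTop, |tail ν (fun r => σ * r) t - ℓ₁ * tail P A t|
      ≤ (c * (∫ ω, |A ω| ^ α ∂P) + δ) * tail P A t := by
  have hA := H.heavy.meas
  have hF := H.heavy.regVar
  set m := ∫ ω, |A ω| ^ α ∂P
  obtain ⟨η, hη0, hη1, hηm, hηp⟩ : ∃ η : ℝ, 0 < η ∧ η < 1 ∧
      (1 - η) ^ (-α) * (c * m) + |(1 - η) ^ (-α) - 1| * (|ℓ₁| + |ℓ₂|) < c * m + δ / 5 ∧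
      (1 + η) ^ (-α) * (c * m) + |(1 + η) ^ (-α) - 1| * (|ℓ₁| + |ℓ₂|) < c * m + δ / 5 := by
    have hcont : ContinuousAt
        (fun y : ℝ => y ^ (-α) * (c * m) + |y ^ (-α) - 1| * (|ℓ₁| + |ℓ₂|)) 1 := by
      have := Real.continuousAt_rpow_const 1 (-α) (Or.inl one_ne_zero)
      fun_prop
    have h3 : ∀ᶠ y in 𝓝 (1 : ℝ),
        y ^ (-α) * (c * m) + |y ^ (-α) - 1| * (|ℓ₁| + |ℓ₂|) < c * m + δ / 5 := by
      refine hcont.eventually (gt_mem_nhds ?_)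
      simp only [Real.one_rpow, sub_self, abs_zero, zero_mul, add_zero, one_mul]
      linarith
    obtain ⟨r, hr, hball⟩ := Metric.eventually_nhds_iff.1 h3
    have hr2 : 0 < min (r / 2) (1 / 2) := by positivity
    have hr3 : min (r / 2) (1 / 2) < r := (min_le_left _ _).trans_lt (by linarith)
    refine ⟨min (r / 2) (1 / 2), hr2, (min_le_right _ _).trans_lt (by norm_num), hball ?_, hball ?_⟩
    · rw [Real.dist_eq, sub_sub_cancel_left, abs_neg, abs_of_pos hr2]; exact hr3
    · rw [Real.dist_eq, add_sub_cancel_left, abs_of_pos hr2]; exact hr3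
  have hδ5 : 0 < δ / 5 := by positivity
  have hlimK : Tendsto (fun K : ℝ => (∫ y in {r | |r| ≤ K}, f y ∂ν)
      + (ℓ₁ * (∫ ω in {ω | 0 < A ω ∧ A ω ≤ K}, A ω ^ α ∂P)
        + ℓ₂ * ∫ ω in {ω | 0 < -A ω ∧ -A ω ≤ K}, (-A ω) ^ α ∂P)) atTop (𝓝 ℓ₁) := by
    have hfK : Tendsto (fun K : ℝ => ∫ y in {r | |r| ≤ K}, f y ∂ν) atTop (𝓝 (∫ y, f y ∂ν)) := by
      simp_rw [← integral_indicator (measurableSet_abs_le _)]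
      refine tendsto_integral_filter_of_dominated_convergence (fun y => ‖f y‖)
        (Eventually.of_forall fun K => hfint.1.indicator (measurableSet_abs_le K))
        (Eventually.of_forall fun K => ae_of_all _ fun y => norm_indicator_le_norm_self _ _)
        hfint.norm (ae_of_all _ fun y => tendsto_const_nhds.congr' ?_)
      filter_upwards [eventually_ge_atTop |y|] with K hK
      rw [Set.indicator_of_mem (show y ∈ {r : ℝ | |r| ≤ K} from hK)]
    have h3 := hfK.add (((tendsto_setIntegral_rpow H.heavy.pos hA H.heavy.int).const_mul ℓ₁).add
      ((tendsto_setIntegral_rpow (X := fun ω => -A ω) H.heavy.pos hA.neg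
        H.integrable_negPart).const_mul ℓ₂))
    convert h3 using 2
    linarith
  obtain ⟨K, hKs, hK0, hKl⟩ := ((H.eventually_sandwich hσ hC hν hη0 hη1 hδ5).and
    ((eventually_gt_atTop 0).and (hlimK.eventually (Metric.ball_mem_nhds ℓ₁ hδ5)))).exists
  rw [Real.dist_eq] at hKl
  set aK := ∫ ω in {ω | 0 < A ω ∧ A ω ≤ K}, A ω ^ α ∂P
  set bK := ∫ ω in {ω | 0 < -A ω ∧ -A ω ≤ K}, (-A ω) ^ α ∂P
  set fK := ∫ y in {r | |r| ≤ K}, f y ∂ν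
  filter_upwards [hKs, H.eventually_linSet hc (sub_pos.2 hη1) hδ5 h₁ h₂ hK0,
    H.eventually_linSet hc (by linarith : 0 < 1 + η) hδ5 h₁ h₂ hK0,
    (H.tendsto_compact_part hσ hlim hK0.le).eventually (Metric.ball_mem_nhds fK hδ5)]
    with t ⟨hu, hl⟩ hm hp hg
  have hpos := hF.pos t
  rw [Real.dist_eq] at hg
  set G := (ν.prod P).real {p : ℝ × Ω | t < σ * Ψ p.2 p.1 ∧ |p.1| ≤ K}
  set Q₁ := (P.prod ν).real (linSet A σ K (t * (1 - η)))
  set Q₂ := (P.prod ν).real (linSet A σ K (t * (1 + η)))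
  set F := tail P A t
  set h := tail ν (fun r => σ * r) t
  have hu' : h / F ≤ G / F + Q₁ / F + δ / 5 := by
    rw [← add_div, div_add' _ _ _ hpos.ne']; exact div_le_div_of_nonneg_right hu hpos.le
  have hl' : G / F + Q₂ / F ≤ h / F + δ / 5 := by
    rw [← add_div, div_add' _ _ _ hpos.ne']; exact div_le_div_of_nonneg_right hl hpos.le
  rw [abs_lt] at hg hKl
  rw [_root_.abs_le] at hm hp
  have key : |h / F - ℓ₁| ≤ c * m + δ := by
    rw [_root_.abs_le]; constructor <;> linarith [hg.1, hg.2, hKl.1, hKl.2, hm.1, hm.2, hp.1, hp.2]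
  have e : h - ℓ₁ * F = (h / F - ℓ₁) * F := by field_simp
  rw [e, abs_mul, abs_of_pos hpos]
  exact mul_le_mul_of_nonneg_right key hpos.le

/-- The upper bound provides a finite initial error c₀. Each contraction step multiplies it by θ =
(1+m)/2, the gap θ - m being spent on δ. Both tails are carried through the induction because the
contraction of either uses both. -/
theorem tendsto_tail_div (H : Model P Ψ A V φ α ν) {C : ℝ} (hC : 0 ≤ C)
    (hν : ∀ t, tail ν (fun r => |r|) t ≤ C * tail P A t) {fp fm : ℝ → ℝ}
    (hfp : Integrable fp ν) (hfm : Integrable fm ν)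
    (hlimp : ∀ᵐ y ∂ν, Tendsto (fun t => P.real {ω | t < 1 * Ψ ω y} / tail P A t) atTop (𝓝 (fp y)))
    (hlimm : ∀ᵐ y ∂ν,
      Tendsto (fun t => P.real {ω | t < -1 * Ψ ω y} / tail P A t) atTop (𝓝 (fm y)))
    {ℓ₁ ℓ₂ : ℝ}
    (hℓ₁ : ℓ₁ = (∫ y, fp y ∂ν) + (∫ ω, max (A ω) 0 ^ α ∂P) * ℓ₁
      + (∫ ω, max (-A ω) 0 ^ α ∂P) * ℓ₂)
    (hℓ₂ : ℓ₂ = (∫ y, fm y ∂ν) + (∫ ω, max (A ω) 0 ^ α ∂P) * ℓ₂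
      + (∫ ω, max (-A ω) 0 ^ α ∂P) * ℓ₁) :
    Tendsto (fun t => tail ν (fun r => 1 * r) t / tail P A t) atTop (𝓝 ℓ₁) := by
  set m := ∫ ω, |A ω| ^ α ∂P with hm
  have hm1 : m < 1 := H.moment
  have hm0 : 0 ≤ m := integral_nonneg fun ω => by positivity
  set c₀ := C + |ℓ₁| + |ℓ₂| + 1 with hc₀
  have hc₀0 : 0 < c₀ := by positivity
  set θ := (1 + m) / 2 with hθ
  have hθ0 : 0 < θ := by rw [hθ]; linarith
  have hbase : ∀ (s : ℝ), |s| = 1 → ∀ ℓ : ℝ, |ℓ| ≤ |ℓ₁| + |ℓ₂| →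
      ∀ t, |tail ν (fun r => s * r) t - ℓ * tail P A t| ≤ c₀ * tail P A t := by
    intro s hs ℓ hℓ t
    have hpos := H.heavy.regVar.pos t
    have h1 : tail ν (fun r => s * r) t ≤ C * tail P A t := by
      refine (measureReal_mono fun r (hr : t < s * r) => ?_).trans (hν t)
      refine hr.trans_le ((le_abs_self _).trans ?_)
      rw [abs_mul, hs, one_mul]
    calc _ ≤ |tail ν (fun r => s * r) t| + |ℓ * tail P A t| := abs_sub _ _
      _ = tail ν (fun r => s * r) t + |ℓ| * tail P A t := by
          rw [abs_mul, abs_of_pos hpos, abs_of_nonneg (tail_nonneg _ _ _)]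
      _ ≤ C * tail P A t + (|ℓ₁| + |ℓ₂|) * tail P A t := by gcongr
      _ ≤ _ := by rw [hc₀]; nlinarith
  have hiter : ∀ n : ℕ,
      (∀ᶠ t in atTop, |tail ν (fun r => 1 * r) t - ℓ₁ * tail P A t| ≤ c₀ * θ ^ n * tail P A t) ∧
      ∀ᶠ t in atTop, |tail ν (fun r => -1 * r) t - ℓ₂ * tail P A t| ≤ c₀ * θ ^ n * tail P A t := by
    intro n
    induction n with
    | zero =>
      simp only [pow_zero, mul_one]
      exact ⟨Eventually.of_forall (hbase 1 abs_one ℓ₁ (by linarith [abs_nonneg ℓ₂])),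
        Eventually.of_forall (hbase (-1) (by simp) ℓ₂ (by linarith [abs_nonneg ℓ₁]))⟩
    | succ n ih =>
      have hcn : 0 < c₀ * θ ^ n := by positivity
      have hδ : 0 < c₀ * θ ^ n * (θ - m) := mul_pos hcn (by rw [hθ]; linarith)
      have e : c₀ * θ ^ n * m + c₀ * θ ^ n * (θ - m) = c₀ * θ ^ (n + 1) := by ring
      have h3 := H.eventually_contraction abs_one hC hν hfp hlimp hcn.le hδ hℓ₁ ih.1 ih.2
      have h4 := H.eventually_contraction (σ := -1) (by simp) hC hν hfm hlimm hcn.le hδ hℓ₂ ih.2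
        (by rw [neg_neg]; exact ih.1)
      rw [← hm, e] at h3 h4
      exact ⟨h3, h4⟩
  rw [Metric.tendsto_nhds]
  intro ε hε
  have hlim0 : Tendsto (fun n : ℕ => c₀ * θ ^ n) atTop (𝓝 0) := by
    have := (tendsto_pow_atTop_nhds_zero_of_lt_one hθ0.le (by rw [hθ]; linarith)).const_mul c₀
    rwa [mul_zero] at this
  obtain ⟨n, hn⟩ := (hlim0.eventually (gt_mem_nhds hε)).exists
  filter_upwards [(hiter n).1] with t ht
  have hpos := H.heavy.regVar.pos t
  have e : tail ν (fun r => 1 * r) t / tail P A t - ℓ₁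
      = (tail ν (fun r => 1 * r) t - ℓ₁ * tail P A t) / tail P A t := by field_simp
  rw [Real.dist_eq, e, abs_div, abs_of_pos hpos]
  exact ((div_le_iff₀ hpos).2 ht).trans_lt hn

end Model

end IFS

/-! ### Consequences of the hypotheses and assembly -/

namespace IFS

theorem exists_le_mul_add_of_isLittleO {φ : ℝ → ℝ}
    (hφbdd : ∀ K : ℝ, ∃ C : ℝ, ∀ x, 0 ≤ x → x ≤ K → φ x ≤ C)
    (hφo : φ =o[atTop] (fun x : ℝ => x)) {ε : ℝ} (hε : 0 < ε) :
    ∃ C : ℝ, 0 ≤ C ∧ ∀ x, 0 ≤ x → φ x ≤ ε * x + C := by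
  obtain ⟨K, hK⟩ := eventually_atTop.1 (hφo.bound hε)
  obtain ⟨C, hC⟩ := hφbdd K
  refine ⟨max C 0, le_max_right _ _, fun x hx => ?_⟩
  rcases le_total x K with h | h
  · exact (hC x hx h).trans ((le_max_left C 0).trans (le_add_of_nonneg_left (by positivity)))
  · have h1 := hK x h
    rw [Real.norm_of_nonneg hx] at h1
    exact ((le_abs_self _).trans h1).trans (le_add_of_nonneg_right (le_max_right _ _))

/-- |Ψ(x) - x| is at most a constant times V ∨ 1. This moment is what controls the increments of the
backward iterates. -/
theorem integrable_displacement {Ω : Type*} [MeasurableSpace Ω] {P : Measure Ω}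
    [IsProbabilityMeasure P] {Ψ : Ω → ℝ → ℝ} {A V : Ω → ℝ} {α x c : ℝ} (hα : 0 < α)
    (hΨ : Measurable Ψ) (hAV : ∀ ω, |A ω| ≤ V ω) (hV : Integrable (fun ω => V ω ^ α) P)
    (hc : 0 ≤ c) (hx : ∀ᵐ ω ∂P, |rem Ψ A ω x| ≤ V ω * c) :
    Integrable (fun ω => |Ψ ω x - x| ^ α) P := by
  have hm : Measurable fun ω => |Ψ ω x - x| ^ α :=
    ((((measurable_pi_apply x).comp hΨ).sub (measurable_const (a := x))).abs).pow_const α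
  refine ((hV.add (integrable_const 1)).const_mul ((c + |x| + |x|) ^ α)).mono'
    hm.aestronglyMeasurable ?_
  filter_upwards [hx] with ω hω
  have hV0 : 0 ≤ V ω := (abs_nonneg _).trans (hAV ω)
  rw [Real.norm_of_nonneg (by positivity)]
  have h1 : |Ψ ω x - x| ≤ (c + |x| + |x|) * max (V ω) 1 := by
    have h2 : Ψ ω x - x = rem Ψ A ω x + A ω * x - x := by rw [rem]; ring
    have h3 : |Ψ ω x - x| ≤ |rem Ψ A ω x| + |A ω| * |x| + |x| := by
      rw [h2, ← abs_mul]
      exact (abs_sub _ _).trans (add_le_add_left (abs_add_le _ _) _)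
    have h4 := mul_le_mul_of_nonneg_right (hAV ω) (abs_nonneg x)
    have h5 := le_max_left (V ω) 1
    have h6 := le_max_right (V ω) 1
    nlinarith [abs_nonneg x, mul_le_mul_of_nonneg_right h5 hc,
      mul_le_mul_of_nonneg_right h5 (abs_nonneg x), mul_le_mul_of_nonneg_right h6 (abs_nonneg x)]
  refine (Real.rpow_le_rpow (abs_nonneg _) h1 hα.le).trans ?_
  rw [Real.mul_rpow (by positivity) (by positivity)]
  refine mul_le_mul_of_nonneg_left ?_ (by positivity)
  show max (V ω) 1 ^ α ≤ V ω ^ α + 1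
  rcases le_total (V ω) 1 with h | h
  · rw [max_eq_right h, Real.one_rpow]
    exact le_add_of_nonneg_left (by positivity)
  · rw [max_eq_left h]; linarith

end IFS

theorem mainTheorem1
    -- the generic random Lipschitz map `Ψ` and the coefficients `A`, `B`
    {Ω : Type*} [MeasurableSpace Ω] (P : Measure Ω) [IsProbabilityMeasure P]
    (Ψ : Ω → ℝ → ℝ) (A B : Ω → ℝ)
    (hΨm : Measurable Ψ) (hAm : Measurable A) (hBm : Measurable B)
    (hΨlip : ∀ ω, ∃ K : ℝ≥0, LipschitzWith K (Ψ ω))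
    -- `E[log Lip(Ψ)] < 0`
    (hlog : IFS.NegLogMean P (fun ω => IFS.lip (Ψ ω)))
    -- `φ` is nonnegative and locally bounded on `[0, ∞)`, and `φ(x) = o(x)`
    (φ : ℝ → ℝ) (hφ0 : ∀ x, 0 ≤ x → 0 ≤ φ x)
    (hφbdd : ∀ K : ℝ, ∃ C : ℝ, ∀ x, 0 ≤ x → x ≤ K → φ x ≤ C)
    (hφo : φ =o[atTop] (fun x : ℝ => x))
    -- `|Φ(x)| ≤ B φ(|x|)` a.s. for every `x` in the support of every law solving `R =_d Ψ(R)`,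
    -- and for at least one `x`
    (hΦ : ∀ ν : ProbabilityMeasure ℝ, IFS.Solves P Ψ ν → ∀ x ∈ (ν : Measure ℝ).support,
      ∀ᵐ ω ∂P, |IFS.rem Ψ A ω x| ≤ B ω * φ |x|)
    (hΦ₀ : ∃ x₀ : ℝ, ∀ᵐ ω ∂P, |IFS.rem Ψ A ω x₀| ≤ B ω * φ |x₀|)
    -- `P[B ∨ |A| > t] = O(P[A > t])`
    (hBA : IFS.tail P (fun ω => max (B ω) |A ω|) =O[atTop] IFS.tail P A)
    -- the tail of `A` is regularly varying with index `-α`, and `E|A|^α < 1`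
    (α : ℝ) (hα : 0 < α)
    (hreg : ∀ y : ℝ, 0 < y →
      Tendsto (fun t => IFS.tail P A (t * y) / IFS.tail P A t) atTop (𝓝 (y ^ (-α))))
    (hAint : Integrable (fun ω => |A ω| ^ α) P)
    (hAmom : ∫ ω, |A ω| ^ α ∂P < 1)
    -- `P[A₊ A'₊ > t] ∼ 2 E[A₊^α] P[A > t]`, with `A'` an independent copy of `A`
    (hconv : Tendsto
      (fun t => IFS.tail (P.prod P) (fun p : Ω × Ω => max (A p.1) 0 * max (A p.2) 0) t
        / IFS.tail P A t)
      atTop (𝓝 (2 * ∫ ω, max (A ω) 0 ^ α ∂P)))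
    -- the chain: i.i.d. copies of `Ψ`, and a starting point independent of them
    {Ω' : Type*} [MeasurableSpace Ω'] (P' : Measure Ω') [IsProbabilityMeasure P']
    (Ψs : ℕ → Ω' → ℝ → ℝ) (R₀ : Ω' → ℝ)
    (hΨsm : ∀ n, Measurable (Ψs n)) (hR₀m : Measurable R₀)
    (hΨslip : ∀ n ω, ∃ K : ℝ≥0, LipschitzWith K (Ψs n ω))
    (hΨslaw : ∀ n, IdentDistrib (Ψs n) Ψ P' P)
    (hΨsindep : iIndepFun Ψs P')
    (hR₀indep : IndepFun R₀ (fun ω n => Ψs n ω) P') :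
    -- `ν` is the law of `R`
    ∃ ν : ProbabilityMeasure ℝ,
      -- `R` is the unique solution of `R =_d Ψ(R)`, and the chain converges weakly to it
      IFS.Solves P Ψ ν ∧ (∀ ν' : ProbabilityMeasure ℝ, IFS.Solves P Ψ ν' → ν' = ν) ∧
      TendstoInDistribution (IFS.chain Ψs R₀) atTop (id : ℝ → ℝ) (fun _ => P') (ν : Measure ℝ) ∧
      -- `P[|R| > t] = O(P[A > t])`
      (IFS.tail (ν : Measure ℝ) (fun r => |r|) =O[atTop] IFS.tail P A) ∧
      -- part (a)
      ((∀ᵐ ω ∂P, Monotone (Ψ ω)) →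
        ((fun t => P.real {ω | t < A ω ∧ IFS.rem Ψ A ω 1 < -t}) =o[atTop] IFS.tail P A) →
        (0 < (ν : Measure ℝ) {r | 1 ≤ r} ∨ ∀ K : ℝ, 0 < (ν : Measure ℝ) {r | r < -K}) →
        (IFS.tail (ν : Measure ℝ) (fun r => |r|) =Θ[atTop] IFS.tail P A)) ∧
      -- part (b)
      (∀ fp fm : ℝ → ℝ, Measurable fp → Measurable fm → (∀ y, 0 ≤ fp y) → (∀ y, 0 ≤ fm y) →
        (∀ y ∈ (ν : Measure ℝ).support,
          Tendsto (fun t => P.real {ω | t < Ψ ω y} / IFS.tail P A t) atTop (𝓝 (fp y))) →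
        (∀ y ∈ (ν : Measure ℝ).support,
          Tendsto (fun t => P.real {ω | Ψ ω y < -t} / IFS.tail P A t) atTop (𝓝 (fm y))) →
        Integrable fp (ν : Measure ℝ) ∧ Integrable fm (ν : Measure ℝ) ∧
        Tendsto (fun t => IFS.tail (ν : Measure ℝ) (fun r => r) t / IFS.tail P A t) atTop
          (𝓝 (((1 - ∫ ω, max (A ω) 0 ^ α ∂P) * (∫ r, fp r ∂(ν : Measure ℝ))
                + (∫ ω, max (-A ω) 0 ^ α ∂P) * (∫ r, fm r ∂(ν : Measure ℝ)))
              / ((1 - (∫ ω, max (A ω) 0 ^ α ∂P) - (∫ ω, max (-A ω) 0 ^ α ∂P))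
                * (1 - (∫ ω, max (A ω) 0 ^ α ∂P) + (∫ ω, max (-A ω) 0 ^ α ∂P)))))) := by
  have hF := IFS.regVar_tail hreg
  -- `B` may be negative and need not dominate |A|. `V` is nonnegative and dominates both, and the
  -- error bound survives because φ ≥ 0.
  set V : Ω → ℝ := fun ω => max (B ω) |A ω| with hVdef
  have hVm : Measurable V := hBm.max hAm.abs
  have hAV : ∀ ω, |A ω| ≤ V ω := fun ω => le_max_right _ _
  have hV0 : ∀ ω, 0 ≤ V ω := fun ω => (abs_nonneg _).trans (hAV ω)
  have hVt : ∃ C : ℝ, 0 ≤ C ∧ ∀ t, IFS.tail P V t ≤ C * IFS.tail P A t := by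
    obtain ⟨C, hC⟩ := hBA.bound
    refine hF.exists_global_bound (IFS.tail_le_one P V) (C := C) ?_
    filter_upwards [hC] with t ht
    rwa [Real.norm_of_nonneg (IFS.tail_nonneg _ _ _),
      Real.norm_of_nonneg (IFS.tail_nonneg _ _ _)] at ht
  have hint : Integrable (fun ω => max (A ω) 0 ^ α) P := by
    refine hAint.mono' ((hAm.max measurable_const).pow_const α).aestronglyMeasurable
      (ae_of_all _ fun ω => ?_)
    rw [Real.norm_of_nonneg (by positivity)]
    exact Real.rpow_le_rpow (le_max_right _ _) (max_le (le_abs_self _) (abs_nonneg _)) hα.le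
  have heavy : IFS.HeavyTail P A α := ⟨hα, hAm, hF, hint, fun ε hε =>
    IFS.eventually_real_bigSet_self_le hα hF hAm hint hconv hε⟩
  have hVint : Integrable (fun ω => V ω ^ α) P := by
    obtain ⟨C, hC, h⟩ := hVt
    exact IFS.integrable_rpow_of_tail_le hα hAm hint hVm hV0 hC h
  have hcont : ∀ ω, Continuous (Ψ ω) := fun ω => by
    obtain ⟨K, hK⟩ := hΨlip ω; exact hK.continuous
  have hcop : IFS.Copies P Ψ P' Ψs := ⟨hΨsm, hΨslip, hΨslaw, hΨsindep⟩
  have hBV : ∀ x : ℝ, ∀ᵐ ω ∂P, |IFS.rem Ψ A ω x| ≤ B ω * φ |x| →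
      |IFS.rem Ψ A ω x| ≤ V ω * φ |x| := fun x => ae_of_all _ fun ω h =>
    h.trans (mul_le_mul_of_nonneg_right (le_max_left _ _) (hφ0 _ (abs_nonneg x)))
  obtain ⟨M, hMint, hMneg⟩ := IFS.exists_integral_logLip_neg hΨm hΨlip hlog
  obtain ⟨x₀, hx₀⟩ := hΦ₀
  obtain ⟨ν, hstat, hlim⟩ := hcop.exists_stationary hΨm hcont hMint hMneg hα
    (IFS.integrable_displacement hα hΨm hAV hVint (hφ0 _ (abs_nonneg x₀))
      (by filter_upwards [hBV x₀, hx₀] with ω h h' using h h'))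
  have hlimall := hcop.tendsto_iterLaw hΨm hcont hMint hMneg hlim
  have hsolves : IFS.Solves P Ψ ν := hstat
  have H : IFS.Model P Ψ A V φ α (ν : Measure ℝ) :=
    { heavy := heavy
      measΨ := hΨm
      cont := hcont
      measV := hVm
      abs_le := hAV
      tail_le := hVt
      phi_le := fun ε hε => IFS.exists_le_mul_add_of_isLittleO hφbdd hφo hε
      moment := hAmom
      approx := by
        filter_upwards [Measure.support_mem_ae] with x hx
        filter_upwards [hBV x, hΦ ν hsolves x hx] with ω h h' using h h'
      stationary := hstat }
  obtain ⟨C, hC, hνt⟩ := H.exists_tail_bound hlimall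
  have hO : IFS.tail (ν : Measure ℝ) (fun r => |r|) =O[atTop] IFS.tail P A := by
    refine IsBigO.of_bound C (Eventually.of_forall fun t => ?_)
    rw [Real.norm_of_nonneg (IFS.tail_nonneg _ _ _), Real.norm_of_nonneg (IFS.tail_nonneg _ _ _)]
    exact hνt t
  refine ⟨ν, hsolves, fun ν' hν' => ?_, hcop.tendsto_chain hΨm hcont hMint hMneg hlim hR₀m, hO,
    fun hmono ho hcase => ⟨hO, ?_⟩, ?_⟩
  -- A second solution is fixed by the transition operator, so its constant sequence of iterates
  -- converges to `ν`.
  · have h1 := hlimall ν'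
    have h2 : IFS.iterLaw P hΨm hcont ν' = fun _ => ν' :=
      funext fun n => IFS.iterLaw_of_stationary hΨm hcont hν' n
    rw [h2] at h1
    exact tendsto_nhds_unique tendsto_const_nhds h1
  · obtain ⟨c, hc, h⟩ : ∃ c : ℝ, 0 < c ∧ ∀ᶠ t in atTop,
        c * IFS.tail P A t ≤ IFS.tail (ν : Measure ℝ) (fun r => |r|) t :=
      hcase.elim (H.lower_bound_of_one_le hmono ho) (H.lower_bound_of_unbounded_below hmono)
    refine IsBigO.of_bound c⁻¹ ?_
    filter_upwards [h] with t ht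
    rw [Real.norm_of_nonneg (IFS.tail_nonneg _ _ _), Real.norm_of_nonneg (IFS.tail_nonneg _ _ _),
      ← div_eq_inv_mul, le_div_iff₀ hc, mul_comm]
    exact ht
  · intro fp fm hfpm hfmm hfp0 hfm0 hp hm
    have hσt : ∀ σ : ℝ, |σ| = 1 → ∀ t,
        IFS.tail (ν : Measure ℝ) (fun r => σ * r) t ≤ C * IFS.tail P A t := fun σ hσ t => by
      refine (measureReal_mono fun r (hr : t < σ * r) => ?_).trans (hνt t)
      refine hr.trans_le ((le_abs_self _).trans ?_)
      rw [abs_mul, hσ, one_mul]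
    have hlimp : ∀ᵐ y ∂(ν : Measure ℝ), Tendsto
        (fun t => P.real {ω | t < 1 * Ψ ω y} / IFS.tail P A t) atTop (𝓝 (fp y)) := by
      filter_upwards [Measure.support_mem_ae] with y hy
      simpa only [one_mul] using hp y hy
    have hlimm : ∀ᵐ y ∂(ν : Measure ℝ), Tendsto
        (fun t => P.real {ω | t < -1 * Ψ ω y} / IFS.tail P A t) atTop (𝓝 (fm y)) := by
      filter_upwards [Measure.support_mem_ae] with y hy
      simpa only [neg_one_mul, lt_neg] using hm y hy
    have hfpi := H.integrable_of_tendsto (hσt 1 abs_one) hfpm hfp0 hlimp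
    have hfmi := H.integrable_of_tendsto (hσt (-1) (by simp)) hfmm hfm0 hlimm
    refine ⟨hfpi, hfmi, ?_⟩
    have hmom : (∫ ω, max (A ω) 0 ^ α ∂P) + (∫ ω, max (-A ω) 0 ^ α ∂P) < 1 := by
      rw [← H.integral_abs_rpow]; exact hAmom
    have hmm0 : 0 ≤ ∫ ω, max (-A ω) 0 ^ α ∂P := integral_nonneg fun ω => by positivity
    set a := ∫ ω, max (A ω) 0 ^ α ∂P
    set b := ∫ ω, max (-A ω) 0 ^ α ∂P
    set p := ∫ r, fp r ∂(ν : Measure ℝ) with hpdef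
    set q := ∫ r, fm r ∂(ν : Measure ℝ) with hqdef
    have h1 : 1 - a - b ≠ 0 := by linarith
    have h2 : 1 - a + b ≠ 0 := by linarith
    have h3 := H.tendsto_tail_div hC hνt hfpi hfmi hlimp hlimm
      -- Cramer's rule for (1-a)ℓ₁ - bℓ₂ = p and (1-a)ℓ₂ - bℓ₁ = q, whose determinant is (1-a)² - b²
      -- = (1-a-b)(1-a+b).
      (ℓ₁ := ((1 - a) * p + b * q) / ((1 - a - b) * (1 - a + b)))
      (ℓ₂ := ((1 - a) * q + b * p) / ((1 - a - b) * (1 - a + b)))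
      (by rw [← hpdef]; field_simp; ring) (by rw [← hqdef]; field_simp; ring)
    simpa only [one_mul] using h3
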